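/- Let $\ell\ge 3$. Identify a partition with its Young diagram; the box in row $a$ and column $b$ has residue $b-a \bmod \ell$. For $i\in\mathbb Z/\ell\mathbb Z$ mark every addable box of residue $i$ of a partition $\lambda$ by $+$ and every removable box of residue $i$ by $-$. The *ladders* are the sets of positions $(a,b)$ with $a,b\ge 1$ on which $a+(\ell-1)(b-1)$ is constant; smaller values of this constant mean ladders further to the left. The *$i$-signature* of $\lambda$ is the word of signs read by rows from bottom to top; the *ladder $i$-signature* is the word read ladder by ladder from left to right, each ladder from top to bottom. In either case one deletes adjacent pairs $-+$ repeatedly until a word $+\cdots+-\cdots-$ remains; $\varphi_i$ (resp. $\hat\varphi_i$) is the number of remaining $+$'s and $\varepsilon_i$ (resp. $\hat\varepsilon_i$) the number of remaining $-$'s; $\tilde f_i$ (resp. $\hat f_i$) adds the box of the rightmost remaining $+$, $\tilde e_i$ (resp. $\hat e_i$) removes the box of the leftmost remaining $-$, and the result is $0$ if there is no such box. The weight of $\lambda$ is $\Lambda_0-\sum_i c_i\alpha_i$, a weight of $\widehat{\mathfrak{sl}}_\ell$, where $c_i$ is the number of boxes of residue $i$. Let $B(\Lambda_0)$ be the set of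 $\ell$-regular partitions (no nonzero part occurs $\ell$ or more times) with the operators $\tilde e_i,\tilde f_i$ (the Misra–Miwa crystal), and let the ladder crystal $B(\Lambda_0)^L$ be the set of partitions obtained from $\emptyset$ by applying operators $\hat f_i$, with the operators $\hat e_i,\hat f_i$. The *regularization* $\mathcal R\lambda$ of a partition $\lambda$ is the partition obtained by moving all boxes to the top of their ladders. The *locked* boxes of $\lambda$ are the smallest set of boxes such that (I) a box $x$ of $\lambda$ is locked if it is in the first row or the box directly above it is locked, and every position not in $\lambda$ that lies on the ladder of $x$ below $x$ has directly above it a position not in $\lambda$; (II) every box to the left of a locked box in the same row is locked. The *deregularization* $\mathcal S\lambda$ is the diagram obtained from $\lambda$ by keeping the locked boxes and moving, on each ladder, the unlocked boxes to the lowest positions of that ladder that are not held by locked boxes. Then the operators of $B(\Lambda_0)$ and of $B(\Lambda_0)^L$ send nodes to nodes or to $0$, and for every node $\lambda$ of $B(\Lambda_0)^L$ and every $i$, with $\mathcal R 0=0$, $$\mathcal R\hat f_i\lambda=\tilde f_i\mathcal R\lambda,\qquad \mathcal R\hat e_i\lambda=\tilde e_i\mathcal R\lambda .$$ The map $\mathcal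 R$ is an isomorphism of crystals $B(\Lambda_0)^L\to B(\Lambda_0)$: it is a bijection of the nodes that commutes with the crystal operators as above and satisfies $\varphi_i(\mathcal R\lambda)=\hat\varphi_i(\lambda)$, $\varepsilon_i(\mathcal R\lambda)=\hat\varepsilon_i(\lambda)$ and $\mathrm{wt}(\mathcal R\lambda)=\mathrm{wt}(\lambda)$. Its inverse is $\mathcal S$: for every $\ell$-regular $\mu$ the diagram $\mathcal S\mu$ is a node of $B(\Lambda_0)^L$ with $\mathcal R\mathcal S\mu=\mu$, and $\mathcal S\mathcal R\lambda=\lambda$ for every node $\lambda$ of $B(\Lambda_0)^L$. -/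

import Mathlib

/-! Partitions are Young diagrams. A box is a pair `(a, b)` = (row, column), both counted
from `0`, in English convention: row `0` is the top row, and going up means decreasing `a`. -/

namespace LadderCrystal

/-! ### Boxes, residues, addable and removable boxes -/

/-- The residue `b - a mod ℓ` of the position in row `a` and column `b`. -/
def residue (ℓ : ℕ) (x : ℕ × ℕ) : ZMod ℓ := (x.2 : ZMod ℓ) - (x.1 : ZMod ℓ)

/-- A position outside the diagram that can be added to it so that the result is a diagram. -/
def IsAddable (μ : YoungDiagram) (x : ℕ × ℕ) : Prop :=
  x ∉ μ ∧ IsLowerSet (↑(insert x μ.cells) : Set (ℕ × ℕ))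

/-- A box of the diagram that can be removed so that the result is a diagram. -/
def IsRemovable (μ : YoungDiagram) (x : ℕ × ℕ) : Prop :=
  x ∈ μ ∧ IsLowerSet (↑(μ.cells.erase x) : Set (ℕ × ℕ))

/-- `λ ∪ x` for an addable position `x`. -/
def addBox (μ : YoungDiagram) (x : ℕ × ℕ) (h : IsAddable μ x) : YoungDiagram :=
  ⟨insert x μ.cells, h.2⟩

/-- `λ \ x` for a removable box `x`. -/
def removeBox (μ : YoungDiagram) (x : ℕ × ℕ) (h : IsRemovable μ x) : YoungDiagram :=
  ⟨μ.cells.erase x, h.2⟩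

theorem IsAddable.mem_range {μ : YoungDiagram} {x : ℕ × ℕ} (h : IsAddable μ x) :
    x ∈ Finset.range (μ.colLen 0 + 1) ×ˢ Finset.range (μ.rowLen 0 + 1) := by
  obtain ⟨a, b⟩ := x
  obtain ⟨h1, h2⟩ := h
  simp only [Finset.mem_product, Finset.mem_range]
  constructor
  · rcases a with _ | a
    · omega
    · have h3 : ((a, 0) : ℕ × ℕ) ∈ (↑(insert (a + 1, b) μ.cells) : Set (ℕ × ℕ)) :=
        h2 (a := (a + 1, b)) (b := (a, 0)) (by simp) (by simp)
      have h4 : ((a, 0) : ℕ × ℕ) ∈ μ := by simpa using h3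
      have := YoungDiagram.mem_iff_lt_colLen.1 h4
      omega
  · rcases b with _ | b
    · omega
    · have h3 : ((0, b) : ℕ × ℕ) ∈ (↑(insert (a, b + 1) μ.cells) : Set (ℕ × ℕ)) :=
        h2 (a := (a, b + 1)) (b := (0, b)) (by simp) (by simp)
      have h4 : ((0, b) : ℕ × ℕ) ∈ μ := by simpa using h3
      have := YoungDiagram.mem_iff_lt_rowLen.1 h4
      omega

open Classical in
/-- The set of all addable and removable boxes of residue `i`. -/
noncomputable def signedBoxes (ℓ : ℕ) (i : ZMod ℓ) (μ : YoungDiagram) : Finset (ℕ × ℕ) :=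
  ((Finset.range (μ.colLen 0 + 1) ×ˢ Finset.range (μ.rowLen 0 + 1)) ∪ μ.cells).filter
    fun x => (IsAddable μ x ∨ IsRemovable μ x) ∧ residue ℓ x = i

theorem mem_signedBoxes {ℓ : ℕ} {i : ZMod ℓ} {μ : YoungDiagram} {x : ℕ × ℕ} :
    x ∈ signedBoxes ℓ i μ ↔ (IsAddable μ x ∨ IsRemovable μ x) ∧ residue ℓ x = i := by
  classical
  unfold signedBoxes
  rw [Finset.mem_filter, Finset.mem_union]
  constructor
  · exact fun h => h.2
  · rintro ⟨h | h, hi⟩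
    · exact ⟨Or.inl h.mem_range, Or.inl h, hi⟩
    · exact ⟨Or.inr ((YoungDiagram.mem_cells _).2 h.1), Or.inr h, hi⟩

/-! ### Ladders and reading orders -/

/-- The number of the ladder of a position: two positions lie on the same ladder iff moving one
column to the right goes with moving `ℓ - 1` rows up. Ladders with smaller numbers are further
to the left; ladder number `k` is the one through `(k, 0)`. -/
def ladderIndex (ℓ : ℕ) (x : ℕ × ℕ) : ℕ := x.1 + (ℓ - 1) * x.2

/-- All positions on the `k`-th ladder (for `2 ≤ ℓ` they all have both coordinates `≤ k`). -/
def ladder (ℓ k : ℕ) : Finset (ℕ × ℕ) :=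
  (Finset.range (k + 1) ×ˢ Finset.range (k + 1)).filter fun x => ladderIndex ℓ x = k

/-- Reading from bottom left to top right: lower rows first. -/
def rowKey (x : ℕ × ℕ) : ℕᵒᵈ ×ₗ ℕ := toLex (OrderDual.toDual x.1, x.2)

/-- Reading from the leftmost ladder to the rightmost ladder, each ladder from top to bottom. -/
def ladderKey (ℓ : ℕ) (x : ℕ × ℕ) : ℕ ×ₗ (ℕ ×ₗ ℕ) := toLex (ladderIndex ℓ x, toLex x)

theorem rowKey_injective : Function.Injective rowKey := fun x y h => by
  have h' := congrArg ofLex h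
  simp only [rowKey, ofLex_toLex, Prod.mk.injEq] at h'
  exact Prod.ext (OrderDual.toDual.injective h'.1) h'.2

theorem ladderKey_injective (ℓ : ℕ) : Function.Injective (ladderKey ℓ) := fun x y h => by
  have h' := congrArg ofLex h
  simp only [ladderKey, ofLex_toLex, Prod.mk.injEq] at h'
  exact toLex.injective h'.2

/-- The elements of `s`, listed in increasing order of `key`. -/
noncomputable def listBy {α : Type} [LinearOrder α] (key : ℕ × ℕ → α)
    (hkey : Function.Injective key) (s : Finset (ℕ × ℕ)) : List (ℕ × ℕ) :=
  haveI : IsTrans (ℕ × ℕ) fun x y => key x ≤ key y := ⟨fun _ _ _ => le_trans⟩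
  haveI : Std.Antisymm fun x y : ℕ × ℕ => key x ≤ key y :=
    ⟨fun _ _ h h' => hkey (le_antisymm h h')⟩
  haveI : Std.Total fun x y : ℕ × ℕ => key x ≤ key y := ⟨fun _ _ => le_total _ _⟩
  s.sort fun x y => key x ≤ key y

/-! ### Signatures

A signature of `μ` is the list of its addable and removable `i`-boxes in the given reading order.
An entry carries the sign `-` if it is a (removable) box of `μ`, and `+` if it is an (addable)
position outside `μ`. -/

/-- Put `x` in front of a reduced word, cancelling it if a pair `- +` arises. -/
def consCancel (μ : YoungDiagram) (x : ℕ × ℕ) : List (ℕ × ℕ) → List (ℕ × ℕ)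
  | [] => [x]
  | y :: w => if x ∈ μ ∧ y ∉ μ then w else x :: y :: w

/-- The word obtained by repeatedly removing adjacent pairs `- +`. -/
def reduceWord (μ : YoungDiagram) (w : List (ℕ × ℕ)) : List (ℕ × ℕ) :=
  w.foldr (consCancel μ) []

/-- The normal boxes (the `-`'s of the reduced word), from left to right in the word. -/
def normalBoxes (μ : YoungDiagram) (w : List (ℕ × ℕ)) : List (ℕ × ℕ) :=
  (reduceWord μ w).filter fun x => x ∈ μ

/-- The conormal boxes (the `+`'s of the reduced word), from left to right in the word. -/
def conormalBoxes (μ : YoungDiagram) (w : List (ℕ × ℕ)) : List (ℕ × ℕ) :=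
  (reduceWord μ w).filter fun x => x ∉ μ

open Classical in
/-- Add the cogood box (the rightmost `+` of the reduced word); `none` stands for `0`. -/
noncomputable def fOfWord (μ : YoungDiagram) (w : List (ℕ × ℕ)) : Option YoungDiagram :=
  (conormalBoxes μ w).getLast?.bind fun x =>
    if h : IsAddable μ x then some (addBox μ x h) else none

open Classical in
/-- Remove the good box (the leftmost `-` of the reduced word); `none` stands for `0`. -/
noncomputable def eOfWord (μ : YoungDiagram) (w : List (ℕ × ℕ)) : Option YoungDiagram :=
  (normalBoxes μ w).head?.bind fun x =>
    if h : IsRemovable μ x then some (removeBox μ x h) else none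

/-- The `i`-signature: rows read from bottom to top. -/
noncomputable def signature (ℓ : ℕ) (i : ZMod ℓ) (μ : YoungDiagram) : List (ℕ × ℕ) :=
  listBy rowKey rowKey_injective (signedBoxes ℓ i μ)

/-- The ladder `i`-signature: ladders read from left to right, each from top to bottom. -/
noncomputable def ladderSignature (ℓ : ℕ) (i : ZMod ℓ) (μ : YoungDiagram) : List (ℕ × ℕ) :=
  listBy (ladderKey ℓ) (ladderKey_injective ℓ) (signedBoxes ℓ i μ)

/-! ### The two crystals -/

/-- The weight lattice of affine `sl_ℓ`, with basis the fundamental weights `Λ_j` (`j ∈ ℤ/ℓ`)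
and the null root `δ`. -/
abbrev Weight (ℓ : ℕ) : Type := (ZMod ℓ → ℤ) × ℤ

/-- The simple root `α_i = 2Λ_i - Λ_{i+1} - Λ_{i-1} + δ_{i,0} δ`. -/
def simpleRoot (ℓ : ℕ) (i : ZMod ℓ) : Weight ℓ :=
  (2 • Pi.single i 1 - Pi.single (i + 1) 1 - Pi.single (i - 1) 1, if i = 0 then 1 else 0)

/-- The weight `Λ_0 - ∑ c_i α_i`, where `c_i` is the number of boxes of residue `i`. -/
def weight (ℓ : ℕ) (μ : YoungDiagram) : Weight ℓ :=
  (Pi.single 0 1, 0) - ∑ x ∈ μ.cells, simpleRoot ℓ (residue ℓ x)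

/-- The data of a crystal of affine `sl_ℓ` whose nodes are partitions. The value `none` of the
crystal operators stands for `0`. -/
structure PartitionCrystal (ℓ : ℕ) where
  /-- the nodes -/
  nodes : Set YoungDiagram
  /-- the operators `e_i` -/
  e : ZMod ℓ → YoungDiagram → Option YoungDiagram
  /-- the operators `f_i` -/
  f : ZMod ℓ → YoungDiagram → Option YoungDiagram
  /-- the functions `ε_i` -/
  ε : ZMod ℓ → YoungDiagram → ℕ
  /-- the functions `φ_i` -/
  φ : ZMod ℓ → YoungDiagram → ℕ
  /-- the weight function -/
  wt : YoungDiagram → Weight ℓ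

/-- No nonzero part occurs `ℓ` or more times. -/
def IsRegular (ℓ : ℕ) (μ : YoungDiagram) : Prop :=
  ∀ m : ℕ, 0 < m → μ.rowLens.count m < ℓ

/-- The Misra–Miwa model of the basic crystal `B(Λ_0)` on `ℓ`-regular partitions. -/
noncomputable def basicCrystal (ℓ : ℕ) : PartitionCrystal ℓ where
  nodes := {μ | IsRegular ℓ μ}
  e i μ := eOfWord μ (signature ℓ i μ)
  f i μ := fOfWord μ (signature ℓ i μ)
  ε i μ := (normalBoxes μ (signature ℓ i μ)).length
  φ i μ := (conormalBoxes μ (signature ℓ i μ)).length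
  wt := weight ℓ

/-- The partitions obtained from the empty one by applying the ladder operators `f_i`. -/
inductive IsLadderNode (ℓ : ℕ) : YoungDiagram → Prop
  | empty : IsLadderNode ℓ ⊥
  | step {μ ν : YoungDiagram} (i : ZMod ℓ) (hμ : IsLadderNode ℓ μ)
      (hν : fOfWord μ (ladderSignature ℓ i μ) = some ν) : IsLadderNode ℓ ν

/-- The ladder crystal `B(Λ_0)^L`. -/
noncomputable def ladderCrystal (ℓ : ℕ) : PartitionCrystal ℓ where
  nodes := {μ | IsLadderNode ℓ μ}
  e i μ := eOfWord μ (ladderSignature ℓ i μ)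
  f i μ := fOfWord μ (ladderSignature ℓ i μ)
  ε i μ := (normalBoxes μ (ladderSignature ℓ i μ)).length
  φ i μ := (conormalBoxes μ (ladderSignature ℓ i μ)).length
  wt := weight ℓ

/-- The operators send nodes to nodes or to `0`. -/
structure PartitionCrystal.IsStable {ℓ : ℕ} (C : PartitionCrystal ℓ) : Prop where
  e_mem : ∀ i, ∀ μ ∈ C.nodes, ∀ ν, C.e i μ = some ν → ν ∈ C.nodes
  f_mem : ∀ i, ∀ μ ∈ C.nodes, ∀ ν, C.f i μ = some ν → ν ∈ C.nodes

/-- `F` restricts to an isomorphism of crystals from `C` to `D`: a bijection of the nodes that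
preserves weights, `ε_i` and `φ_i` and commutes with `e_i` and `f_i` (where `F 0 = 0`). -/
structure IsCrystalIso {ℓ : ℕ} (C D : PartitionCrystal ℓ)
    (F : YoungDiagram → YoungDiagram) : Prop where
  source_stable : C.IsStable
  target_stable : D.IsStable
  bijOn : Set.BijOn F C.nodes D.nodes
  map_f : ∀ i, ∀ μ ∈ C.nodes, (C.f i μ).map F = D.f i (F μ)
  map_e : ∀ i, ∀ μ ∈ C.nodes, (C.e i μ).map F = D.e i (F μ)
  map_ε : ∀ i, ∀ μ ∈ C.nodes, D.ε i (F μ) = C.ε i μ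
  map_φ : ∀ i, ∀ μ ∈ C.nodes, D.φ i (F μ) = C.φ i μ
  map_wt : ∀ μ ∈ C.nodes, D.wt (F μ) = C.wt μ

/-! ### Regularization -/

/-- The boxes of `μ` on the `k`-th ladder. -/
def boxesOn (ℓ : ℕ) (μ : YoungDiagram) (k : ℕ) : Finset (ℕ × ℕ) :=
  μ.cells.filter fun x => ladderIndex ℓ x = k

/-- On each ladder, take as many positions from the top as `μ` has boxes on that ladder:
a position is taken iff fewer positions of the ladder lie above it. -/
def regularizationCells (ℓ : ℕ) (μ : YoungDiagram) : Finset (ℕ × ℕ) :=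
  (μ.cells.image (ladderIndex ℓ)).biUnion fun k =>
    (ladder ℓ k).filter fun x =>
      ((ladder ℓ k).filter fun y => y.1 < x.1).card < (boxesOn ℓ μ k).card

theorem mem_ladder {ℓ : ℕ} (hℓ : 2 < ℓ) {k : ℕ} {x : ℕ × ℕ} :
    x ∈ ladder ℓ k ↔ x.1 + (ℓ - 1) * x.2 = k := by
  rw [ladder, Finset.mem_filter, Finset.mem_product, Finset.mem_range, Finset.mem_range]
  constructor
  · exact fun h => h.2
  · intro h
    have : 1 * x.2 ≤ (ℓ - 1) * x.2 := Nat.mul_le_mul_right _ (by omega)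
    exact ⟨⟨by omega, by omega⟩, h⟩

theorem mem_boxesOn {ℓ : ℕ} {μ : YoungDiagram} {k : ℕ} {x : ℕ × ℕ} :
    x ∈ boxesOn ℓ μ k ↔ x ∈ μ ∧ x.1 + (ℓ - 1) * x.2 = k := by
  rw [boxesOn, Finset.mem_filter, YoungDiagram.mem_cells, ladderIndex]

theorem mem_regularizationCells {ℓ : ℕ} (hℓ : 2 < ℓ) {μ : YoungDiagram} {x : ℕ × ℕ} :
    x ∈ regularizationCells ℓ μ ↔
      ((ladder ℓ (ladderIndex ℓ x)).filter fun y => y.1 < x.1).card <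
        (boxesOn ℓ μ (ladderIndex ℓ x)).card := by
  simp only [regularizationCells, Finset.mem_biUnion, Finset.mem_image, Finset.mem_filter]
  constructor
  · rintro ⟨k, -, hx, h⟩
    have hk : ladderIndex ℓ x = k := (mem_ladder hℓ).1 hx
    rwa [hk]
  · intro h
    obtain ⟨y, hy⟩ := Finset.card_pos.1 (lt_of_le_of_lt (Nat.zero_le _) h)
    rw [mem_boxesOn] at hy
    exact ⟨_, ⟨y, (YoungDiagram.mem_cells _).2 hy.1, hy.2⟩, (mem_ladder hℓ).2 rfl, h⟩

theorem regularizationCells_up {ℓ : ℕ} (hℓ : 2 < ℓ) (μ : YoungDiagram) {a b : ℕ}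
    (h : (a + 1, b) ∈ regularizationCells ℓ μ) : (a, b) ∈ regularizationCells ℓ μ := by
  classical
  rw [mem_regularizationCells hℓ] at h ⊢
  set k := ladderIndex ℓ (a, b) with hk
  have hk1 : ladderIndex ℓ (a + 1, b) = k + 1 := by simp only [hk, ladderIndex]; omega
  rw [hk1] at h
  simp only at h ⊢
  set Z := (ladder ℓ (k + 1)).filter fun y => y.1 = 0 with hZ
  have h1 : ((ladder ℓ k).filter fun y => y.1 < a).card + Z.card ≤
      ((ladder ℓ (k + 1)).filter fun y => y.1 < a + 1).card := by
    rw [← Finset.card_image_of_injective ((ladder ℓ k).filter fun y => y.1 < a)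
      (f := fun y => (y.1 + 1, y.2)) (fun x y hxy => by
        simp only [Prod.mk.injEq] at hxy; exact Prod.ext (by omega) hxy.2),
      ← Finset.card_union_of_disjoint]
    · apply Finset.card_le_card
      intro y hy
      simp only [Finset.mem_union, Finset.mem_image, Finset.mem_filter, mem_ladder hℓ, hZ] at hy ⊢
      rcases hy with ⟨z, ⟨hz, hz'⟩, rfl⟩ | ⟨hy, hy'⟩
      · exact ⟨by simp only; omega, by simp only; omega⟩
      · exact ⟨hy, by omega⟩
    · rw [Finset.disjoint_left]
      intro y hy hy'
      simp only [Finset.mem_image, Finset.mem_filter, hZ] at hy hy'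
      obtain ⟨z, -, rfl⟩ := hy
      simp at hy'
  have h2 : (boxesOn ℓ μ (k + 1)).card ≤ (boxesOn ℓ μ k).card + Z.card := by
    rw [← Finset.card_image_of_injective (boxesOn ℓ μ k)
      (f := fun y => (y.1 + 1, y.2)) (fun x y hxy => by
        simp only [Prod.mk.injEq] at hxy; exact Prod.ext (by omega) hxy.2)]
    refine le_trans (Finset.card_le_card ?_) (Finset.card_union_le _ _)
    rintro ⟨c, d⟩ hy
    simp only [Finset.mem_union, Finset.mem_image, Finset.mem_filter, mem_ladder hℓ, hZ,
      mem_boxesOn] at hy ⊢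
    rcases c with _ | c
    · exact Or.inr ⟨hy.2, rfl⟩
    · exact Or.inl ⟨(c, d), ⟨μ.up_left_mem (Nat.le_succ c) le_rfl hy.1, by simp only; omega⟩, rfl⟩
  omega

theorem regularizationCells_left {ℓ : ℕ} (hℓ : 2 < ℓ) (μ : YoungDiagram) {a b : ℕ}
    (h : (a, b + 1) ∈ regularizationCells ℓ μ) : (a, b) ∈ regularizationCells ℓ μ := by
  classical
  rw [mem_regularizationCells hℓ] at h ⊢
  set k := ladderIndex ℓ (a, b) with hk
  obtain ⟨m, hm⟩ : ∃ m, ℓ - 1 = m := ⟨_, rfl⟩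
  have hk1 : ladderIndex ℓ (a, b + 1) = k + m := by
    simp only [hk, ladderIndex, hm]; ring
  rw [hk1] at h
  simp only at h ⊢
  have h1 : ((ladder ℓ k).filter fun y => y.1 < a).card ≤
      ((ladder ℓ (k + m)).filter fun y => y.1 < a).card := by
    apply Finset.card_le_card_of_injOn (fun y => (y.1, y.2 + 1))
    · intro y hy
      simp only [Finset.coe_filter, Set.mem_ofPred_eq, mem_ladder hℓ, hm] at hy ⊢
      exact ⟨by rw [mul_add]; omega, hy.2⟩
    · intro x _ y _ hxy
      simp only [Prod.mk.injEq] at hxy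
      exact Prod.ext hxy.1 (by omega)
  by_cases hgap : ∃ z ∈ ladder ℓ (k + m), z ∉ μ
  · obtain ⟨⟨c₀, d₀⟩, hz, hzμ⟩ := hgap
    rw [mem_ladder hℓ, hm] at hz
    simp only at hz
    have h2 : (boxesOn ℓ μ (k + m)).card ≤ (boxesOn ℓ μ k).card := by
      have key : ∀ c d, (c, d) ∈ μ → c + m * d = k + m → ¬ d₀ < d → d < d₀ ∧ m ≤ c := by
        intro c d hμ hcd hd
        rcases Nat.lt_or_ge d d₀ with hlt | hge
        · refine ⟨hlt, ?_⟩
          obtain ⟨t, rfl⟩ := Nat.exists_eq_add_of_lt hlt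
          have : m * (d + t + 1) = m * d + m * t + m := by ring
          omega
        · obtain rfl : d = d₀ := by omega
          obtain rfl : c = c₀ := by omega
          exact absurd hμ hzμ
      apply Finset.card_le_card_of_injOn
        (fun y => if d₀ < y.2 then (y.1, y.2 - 1) else (y.1 - m, y.2))
      · rintro ⟨c, d⟩ hy
        simp only [Finset.mem_coe, mem_boxesOn, hm] at hy ⊢
        split_ifs with hd
        · refine ⟨μ.up_left_mem le_rfl (Nat.sub_le d 1) hy.1, ?_⟩
          obtain ⟨e, rfl⟩ : ∃ e, d = e + 1 := ⟨d - 1, by omega⟩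
          have := hy.2
          rw [mul_add] at this
          simp only [Nat.add_sub_cancel]
          omega
        · refine ⟨μ.up_left_mem (Nat.sub_le c m) le_rfl hy.1, ?_⟩
          have := (key c d hy.1 hy.2 hd).2
          have := hy.2
          simp only
          omega
      · rintro ⟨c, d⟩ hy ⟨c', d'⟩ hy' hxy
        simp only [Finset.mem_coe, mem_boxesOn, hm] at hy hy'
        have k1 := key c d hy.1 hy.2
        have k2 := key c' d' hy'.1 hy'.2
        simp only at hxy
        split_ifs at hxy <;> simp only [Prod.mk.injEq] at hxy ⊢ <;> omega
    omega
  · push Not at hgap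
    have h2 : ladder ℓ k ⊆ boxesOn ℓ μ k := by
      rintro ⟨c, d⟩ hy
      have hy' := hy
      rw [mem_ladder hℓ, hm] at hy'
      rw [mem_boxesOn, hm]
      refine ⟨μ.up_left_mem le_rfl (Nat.le_succ d) (hgap (c, d + 1) ?_), hy'⟩
      rw [mem_ladder hℓ, hm]
      simp only [mul_add] at hy' ⊢
      omega
    refine lt_of_lt_of_le (Finset.card_lt_card ?_) (Finset.card_le_card h2)
    refine Finset.filter_ssubset.2 ⟨(a, b), (mem_ladder hℓ).2 rfl, by simp⟩

theorem isLowerSet_regularizationCells {ℓ : ℕ} (hℓ : 2 < ℓ) (μ : YoungDiagram) :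
    IsLowerSet (↑(regularizationCells ℓ μ) : Set (ℕ × ℕ)) := by
  have hup : ∀ t a b, (a + t, b) ∈ regularizationCells ℓ μ → (a, b) ∈ regularizationCells ℓ μ := by
    intro t
    induction t with
    | zero => exact fun a b h => h
    | succ t ih => exact fun a b h => ih a b (regularizationCells_up hℓ μ h)
  have hleft : ∀ t a b, (a, b + t) ∈ regularizationCells ℓ μ →
      (a, b) ∈ regularizationCells ℓ μ := by
    intro t
    induction t with
    | zero => exact fun a b h => h
    | succ t ih => exact fun a b h => ih a b (regularizationCells_left hℓ μ h)
  rintro ⟨a, b⟩ ⟨c, d⟩ ⟨hca, hdb⟩ h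
  obtain ⟨s, rfl⟩ := Nat.exists_eq_add_of_le (show c ≤ a from hca)
  obtain ⟨t, rfl⟩ := Nat.exists_eq_add_of_le (show d ≤ b from hdb)
  exact hup s c d (hleft t _ d h)

/-- The regularization `R λ`: all boxes are moved up to the top of their ladders. -/
def regularization (ℓ : ℕ) (hℓ : 2 < ℓ) (μ : YoungDiagram) : YoungDiagram :=
  ⟨regularizationCells ℓ μ, isLowerSet_regularizationCells hℓ μ⟩

/-! ### Deregularization -/

/-- Every unoccupied position on the ladder of `x` below `x` has an unoccupied position directly
above it. -/
def LockCondition (ℓ : ℕ) (μ : YoungDiagram) (x : ℕ × ℕ) : Prop :=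
  ∀ c d : ℕ, ladderIndex ℓ (c + 1, d) = ladderIndex ℓ x → x.1 < c + 1 →
    (c + 1, d) ∉ μ → (c, d) ∉ μ

/-- The locked boxes of a partition. -/
inductive IsLocked (ℓ : ℕ) (μ : YoungDiagram) : ℕ × ℕ → Prop
  /-- type I, first row -/
  | firstRow {b : ℕ} (hx : (0, b) ∈ μ) (hc : LockCondition ℓ μ (0, b)) : IsLocked ℓ μ (0, b)
  /-- type I, below a locked box -/
  | belowLocked {a b : ℕ} (hx : (a + 1, b) ∈ μ) (hup : IsLocked ℓ μ (a, b))
      (hc : LockCondition ℓ μ (a + 1, b)) : IsLocked ℓ μ (a + 1, b)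
  /-- type II, to the left of a locked box in the same row -/
  | leftOfLocked {a b b' : ℕ} (hb : b < b') (hr : IsLocked ℓ μ (a, b')) : IsLocked ℓ μ (a, b)

open Classical in
/-- The diagram `S λ`: the locked boxes stay, and on each ladder the unlocked boxes are moved down
to the lowest positions not held by locked boxes (such a position is taken iff the number of
positions below it on the ladder that are not held by locked boxes is smaller than the number of
unlocked boxes on the ladder). -/
noncomputable def deregularizationCells (ℓ : ℕ) (μ : YoungDiagram) : Finset (ℕ × ℕ) :=
  (μ.cells.image (ladderIndex ℓ)).biUnion fun k =>
    (ladder ℓ k).filter fun x => IsLocked ℓ μ x ∨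
      ((ladder ℓ k).filter fun y => x.1 < y.1 ∧ ¬ IsLocked ℓ μ y).card <
        ((boxesOn ℓ μ k).filter fun y => ¬ IsLocked ℓ μ y).card

end LadderCrystal

/-! Everything is compared through ladder counts, the numbers of boxes on the single ladders, which
regularization preserves. The indicator of the addable positions minus the diagonally shifted
indicator of the removable boxes is a combination of shifts of the indicator of the diagram, up to a
constant at the origin (`addInd_sub_remInd`), and a diagonal step raises the ladder number by `ℓ`.
Hence the number of addable boxes on ladder `k + ℓ` minus the number of removable boxes on ladder
`k` depends only on the ladder counts.

The ladders of one residue are `ℓ` apart. If a signature is sorted by ladder, with `+` before `-` on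
each ladder, then the `-`'s of a ladder meet the `+`'s of the next one, so the reduced word,
including the ladder of each letter, depends only on the above differences and on the `+`'s of the
first ladder (`red_eq_of_count`). Two shape conditions produce this sorted form. For the row reading
it is `IsTopJustified`, which amounts to `ℓ`-regularity. For the ladder reading it is
`NoBalancedHook`: the last box of a row is never on the ladder of the first position below a column
crossing that row. Each condition is preserved by the operators of its own reading order.

So the reduced words of `ν` and of its regularization agree in signs and ladders (`map_label_red`),
and the operators change the same ladder count on both sides. Since a top-justified diagram is
determined by its ladder counts, regularization commutes with the operators. Every nonempty regular
partition admits some `e_i`; induction on the size then shows that the ladder nodes are exactly the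
diagrams with `NoBalancedHook`, and that regularization is surjective.

For the inverse, a locked box of `μ` lies in every diagram with the ladder counts of `μ`
(`IsLocked.mem_of_sameLadders`), while in a ladder node `ν` every box above a gap of its ladder is
locked in the regularization of `ν` (`NoBalancedHook.isLocked_of_above`). Thus the unlocked boxes of
`ν` fill the lowest positions left free by the locked ones, which is the recipe of the
deregularization; injectivity follows. -/

namespace LadderCrystal

/-! ### Cancellation of words of signs -/

section Words

variable {α β : Type*}

/-- Put `x` in front of a reduced word, where `s` is true on the letters `-`. -/
def consRed (s : α → Bool) (x : α) : List α → List α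
  | [] => [x]
  | y :: w => if s x && !s y then w else x :: y :: w

/-- The reduced word. -/
def red (s : α → Bool) (w : List α) : List α := w.foldr (consRed s) []

variable {s : α → Bool}

theorem consRed_plus {x : α} (h : s x = false) (w : List α) : consRed s x w = x :: w := by
  cases w <;> simp [consRed, h]

theorem consRed_cons_minus {x : α} {w : List α} (h : ∀ y ∈ w, s y = true) :
    consRed s x w = x :: w := by
  cases w with
  | nil => rfl
  | cons y w => simp [consRed, h y (by simp)]

theorem foldr_plus {w : List α} (h : ∀ x ∈ w, s x = false) (v : List α) :
    w.foldr (consRed s) v = w ++ v := by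
  induction w with
  | nil => rfl
  | cons x w ih =>
    rw [List.foldr_cons, ih fun y hy => h y (by simp [hy]), consRed_plus (h x (by simp))]
    rfl

theorem foldr_minus {w v : List α} (h : ∀ x ∈ w, s x = true) (hv : ∀ x ∈ v, s x = true) :
    w.foldr (consRed s) v = w ++ v := by
  induction w with
  | nil => rfl
  | cons x w ih =>
    have h' : ∀ y ∈ w, s y = true := fun y hy => h y (by simp [hy])
    rw [List.foldr_cons, ih h', consRed_cons_minus]
    · rfl
    · intro y hy
      rcases List.mem_append.1 hy with hy | hy
      exacts [h' y hy, hv y hy]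

theorem red_cons (x : α) (w : List α) : red s (x :: w) = consRed s x (red s w) := rfl

theorem red_of_plus {w : List α} (h : ∀ x ∈ w, s x = false) : red s w = w := by
  rw [red, foldr_plus h, List.append_nil]

theorem red_of_minus {w : List α} (h : ∀ x ∈ w, s x = true) : red s w = w := by
  rw [red, foldr_minus h (by simp), List.append_nil]

/-- A cancelled pair `-+` acts trivially on whatever follows it, so a prefix may be reduced first.
This makes reduction compatible with concatenation. -/
theorem foldr_red (w v : List α) :
    (red s w).foldr (consRed s) v = w.foldr (consRed s) v := by
  induction w with
  | nil => rfl
  | cons x w ih =>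
    rw [red_cons, List.foldr_cons, ← ih]
    cases hw : red s w with
    | nil => rfl
    | cons y u =>
      by_cases h : (s x && !s y) = true
      · have h' : s x = true ∧ s y = false := by simpa using h
        rw [List.foldr_cons, consRed_plus h'.2]
        simp [consRed, h']
      · simp [consRed, h]

theorem red_append (u v : List α) : red s (u ++ v) = (red s u).foldr (consRed s) (red s v) := by
  rw [foldr_red, red, List.foldr_append]
  rfl

theorem red_sublist (w : List α) : (red s w).Sublist w := by
  induction w with
  | nil => exact List.Sublist.refl _
  | cons x w ih =>
    rw [red_cons]
    cases hw : red s w with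
    | nil => simp [consRed]
    | cons y u =>
      rw [hw] at ih
      simp only [consRed]
      split_ifs
      · exact ((List.sublist_cons_self y u).trans ih).trans (List.sublist_cons_self x w)
      · exact ih.cons_cons x

/-- A reduced word has the form `+ ⋯ + - ⋯ -`. -/
theorem red_form (w : List α) :
    ∃ p n, red s w = p ++ n ∧ (∀ x ∈ p, s x = false) ∧ ∀ x ∈ n, s x = true := by
  induction w with
  | nil => exact ⟨[], [], rfl, by simp, by simp⟩
  | cons x w ih =>
    obtain ⟨p, n, h, hp, hn⟩ := ih
    rw [red_cons, h]
    by_cases hx : s x = true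
    · cases p with
      | nil => exact ⟨[], x :: n, by simp [consRed_cons_minus hn], by simp, by simp only [List.mem_cons, forall_eq_or_imp]; exact ⟨hx, hn⟩⟩
      | cons y p =>
        refine ⟨p, n, ?_, fun z hz => hp z (by simp [hz]), hn⟩
        simp [consRed, hx, hp y (by simp)]
    · have hx' : s x = false := by simpa using hx
      exact ⟨x :: p, n, by simp [consRed_plus hx'], by simp [hx']; exact hp, hn⟩

theorem red_map (f : α → β) (t : β → Bool) (w : List α) :
    red t (w.map f) = (red (fun x => t (f x)) w).map f := by
  induction w with
  | nil => rfl
  | cons x w ih =>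
    rw [List.map_cons, red_cons, red_cons, ih]
    cases red (fun x => t (f x)) w with
    | nil => rfl
    | cons y u =>
      simp only [consRed, List.map_cons]
      split_ifs <;> rfl

theorem red_congr {t : α → Bool} {w : List α} (h : ∀ x ∈ w, s x = t x) : red s w = red t w := by
  induction w with
  | nil => rfl
  | cons x w ih =>
    rw [red_cons, red_cons, ih fun y hy => h y (by simp [hy])]
    cases hu : red t w with
    | nil => rfl
    | cons y u =>
      have hy : y ∈ w := (red_sublist w).subset (hu ▸ List.mem_cons_self : y ∈ red t w)
      simp only [consRed, h x (by simp), h y (by simp [hy])]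

/-- Everything before `x` cancels to a word `+ ⋯ +`, everything after `x` to a word `- ⋯ -`. -/
def IsPivot (s : α → Bool) (w : List α) (x : α) : Prop :=
  ∃ u v, w = u ++ x :: v ∧ (∀ y ∈ red s u, s y = false) ∧ ∀ y ∈ red s v, s y = true

theorem IsPivot.red_eq_plus {x : α} {u v : List α} (hu : ∀ y ∈ red s u, s y = false) :
    s x = false → red s (u ++ x :: v) = red s u ++ x :: red s v := by
  intro hx
  rw [red_append, foldr_plus hu, red_cons, consRed_plus hx]

/-- A `-` left over before `x` would cancel `x`, and a `+` left over after `x` would be a later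
survivor. The resulting condition refers only to the letters other than `x`, so it has the same form
for `+` and `-` and is insensitive to a change of the sign of `x`. -/
theorem getLast?_plus_iff {w : List α} (hw : w.Nodup) {x : α} :
    ((red s w).filter fun y => !s y).getLast? = some x ↔ s x = false ∧ IsPivot s w x := by
  constructor
  · intro h
    have hx := List.mem_of_getLast? h
    rw [List.mem_filter] at hx
    have hsx : s x = false := by simpa using hx.2
    refine ⟨hsx, ?_⟩
    obtain ⟨u, v, rfl⟩ := List.append_of_mem ((red_sublist w).subset hx.1)
    have hnd := List.nodup_middle.1 hw
    rw [List.nodup_cons, List.mem_append, not_or] at hnd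
    obtain ⟨p, n, hr, hp, hn⟩ := red_form (s := s) u
    -- If the reduced prefix ended in a `-`, this letter would cancel `x`; since letters do not
    -- repeat, `x` could then not occur in the reduced word.
    have hn0 : n = [] := by
      rcases List.eq_nil_or_concat n with rfl | ⟨n', y, rfl⟩
      · rfl
      · exfalso
        have hy : s y = true := hn y (by simp)
        have hx' := hx.1
        rw [red_append, red_cons, consRed_plus hsx, hr] at hx'
        simp only [List.concat_eq_append, List.foldr_append, List.foldr_cons, List.foldr_nil,
          consRed, hy, hsx] at hx'
        simp only [Bool.not_false, Bool.and_self, if_true] at hx'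
        rw [← List.foldr_append, ← foldr_red] at hx'
        have h1 := (red_sublist (s := s) (red s v)).subset
        have h2 : (red s (p ++ n')).foldr (consRed s) (red s v) =
          red s ((p ++ n') ++ v) := (red_append _ _).symm
        rw [h2] at hx'
        have h3 := (red_sublist _).subset hx'
        rw [List.mem_append] at h3
        rcases h3 with h3 | h3
        · refine hnd.1.1 ((red_sublist (s := s) u).subset ?_)
          rw [hr]
          simp only [List.mem_append] at h3 ⊢
          rcases h3 with h3 | h3
          · exact Or.inl h3
          · exact Or.inr (by simp [h3])
        · exact hnd.1.2 h3
    subst hn0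
    rw [List.append_nil] at hr
    rw [← hr] at hp
    refine ⟨u, v, rfl, hp, ?_⟩
    rw [IsPivot.red_eq_plus hp hsx] at h
    intro y hy
    by_contra hsy
    have hne : (red s v).filter (fun y => !s y) ≠ [] :=
      List.ne_nil_of_mem (List.mem_filter.2 ⟨hy, by simpa using hsy⟩)
    rw [List.filter_append, List.filter_cons_of_pos (by simp [hsx]),
      List.append_cons, List.getLast?_append_of_ne_nil _ hne] at h
    exact hnd.1.2 ((red_sublist v).subset (List.mem_filter.1 (List.mem_of_getLast? h)).1)
  · rintro ⟨hsx, u, v, rfl, hu, hv⟩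
    rw [IsPivot.red_eq_plus hu hsx, List.filter_append, List.filter_cons_of_pos (by simp [hsx]),
      (List.filter_eq_nil_iff.2 fun y hy => by simp [hv y hy] :
        (red s v).filter (fun y => !s y) = [])]
    simp

theorem head?_minus_iff {w : List α} (hw : w.Nodup) {x : α} :
    ((red s w).filter s).head? = some x ↔ s x = true ∧ IsPivot s w x := by
  constructor
  · intro h
    have hx := List.mem_of_head? h
    rw [List.mem_filter] at hx
    have hsx : s x = true := by simpa using hx.2
    refine ⟨hsx, ?_⟩
    obtain ⟨u, v, rfl⟩ := List.append_of_mem ((red_sublist w).subset hx.1)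
    have hnd := List.nodup_middle.1 hw
    rw [List.nodup_cons, List.mem_append, not_or] at hnd
    obtain ⟨p, n, hr, hp, hn⟩ := red_form (s := s) v
    have hp0 : p = [] := by
      cases p with
      | nil => rfl
      | cons y p =>
        exfalso
        have hx' := hx.1
        have h2 : red s (u ++ x :: v) = red s (u ++ red s (p ++ n)) := by
          have hp' : ∀ z ∈ p, s z = false := fun z hz => hp z (by simp [hz])
          have h4 : red s (p ++ n) = p ++ n := by
            rw [red_append, red_of_plus hp', red_of_minus hn, foldr_plus hp']
          rw [red_append, red_cons, hr, red_append u, h4, h4]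
          simp [consRed, hsx, hp y (by simp)]
        rw [h2] at hx'
        have h3 := (red_sublist _).subset hx'
        rw [List.mem_append] at h3
        rcases h3 with h3 | h3
        · exact hnd.1.1 h3
        · refine hnd.1.2 ((red_sublist (s := s) v).subset ?_)
          rw [hr]
          exact List.mem_cons_of_mem _ ((red_sublist _).subset h3)
    subst hp0
    rw [List.nil_append] at hr
    rw [← hr] at hn
    refine ⟨u, v, rfl, ?_, hn⟩
    obtain ⟨p, n, hr', hp, hn'⟩ := red_form (s := s) u
    rw [red_append, red_cons, consRed_cons_minus hn, hr', List.foldr_append, foldr_minus hn'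
      (by simp [hsx]; exact hn), foldr_plus hp, List.filter_append,
      (List.filter_eq_nil_iff.2 fun y hy => by simp [hp y hy] : p.filter s = [])] at h
    cases n with
    | nil => rw [hr']; simpa using hp
    | cons y n =>
      exfalso
      simp only [List.nil_append, List.cons_append, List.filter_cons_of_pos (hn' y (by simp)),
        List.head?_cons, Option.some.injEq] at h
      exact hnd.1.1 ((red_sublist (s := s) u).subset (by rw [hr', ← h]; simp))
  · rintro ⟨hsx, u, v, rfl, hu, hv⟩
    rw [red_append, red_cons, consRed_cons_minus hv, foldr_plus hu, List.filter_append,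
      (List.filter_eq_nil_iff.2 fun y hy => by simp [hu y hy] : (red s u).filter s = [])]
    simp [hsx]

/-- In a word sorted by an injective key, each `+` after a pivot is preceded by some `-`
after the pivot. -/
theorem IsPivot.exists_minus {γ : Type*} [LinearOrder γ] {key : α → γ} {w : List α}
    (hw : w.Pairwise fun x y => key x < key y) {x y : α} (hx : IsPivot s w x)
    (hy : y ∈ w) (hsy : s y = false) (hxy : key x < key y) :
    ∃ z ∈ w, s z = true ∧ key x < key z ∧ key z < key y := by
  obtain ⟨u, v, rfl, hu, hv⟩ := hx
  rw [List.pairwise_append, List.pairwise_cons] at hw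
  have hyv : y ∈ v := by
    simp only [List.mem_append, List.mem_cons] at hy
    rcases hy with hy | rfl | hy
    · exact absurd (hw.2.2 y hy x (by simp)) (not_lt.2 hxy.le)
    · exact absurd hxy (lt_irrefl _)
    · exact hy
  obtain ⟨v₁, v₂, rfl⟩ := List.append_of_mem hyv
  by_cases h : ∀ z ∈ v₁, s z = false
  · have := hv y (by
      rw [IsPivot.red_eq_plus (by rwa [red_of_plus h]) hsy]; simp)
    simp [hsy] at this
  · push Not at h
    obtain ⟨z, hz, hsz⟩ := h
    have h2 := (List.pairwise_append.1 hw.2.1.2).2.2 z hz y (by simp)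
    exact ⟨z, by simp [hz], by simpa using hsz, hw.2.1.1 z (by simp [hz]), h2⟩

/-- In a word sorted by an injective key, each `-` before a pivot is followed by some `+`
before the pivot. -/
theorem IsPivot.exists_plus {γ : Type*} [LinearOrder γ] {key : α → γ} {w : List α}
    (hw : w.Pairwise fun x y => key x < key y) {x y : α} (hx : IsPivot s w x)
    (hy : y ∈ w) (hsy : s y = true) (hxy : key y < key x) :
    ∃ z ∈ w, s z = false ∧ key y < key z ∧ key z < key x := by
  obtain ⟨u, v, rfl, hu, hv⟩ := hx
  rw [List.pairwise_append, List.pairwise_cons] at hw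
  have hyu : y ∈ u := by
    simp only [List.mem_append, List.mem_cons] at hy
    rcases hy with hy | rfl | hy
    · exact hy
    · exact absurd hxy (lt_irrefl _)
    · exact absurd (hw.2.1.1 y hy) (not_lt.2 hxy.le)
  obtain ⟨u₁, u₂, rfl⟩ := List.append_of_mem hyu
  by_cases h : ∀ z ∈ y :: u₂, s z = true
  · obtain ⟨p, n, hr, hp, hn⟩ := red_form (s := s) u₁
    have := hu y (by
      rw [red_append, red_of_minus h, hr, List.foldr_append, foldr_minus hn h, foldr_plus hp]
      simp)
    simp [hsy] at this
  · push Not at h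
    obtain ⟨z, hz, hsz⟩ := h
    have hz' : z ∈ u₂ := by
      rcases List.mem_cons.1 hz with rfl | hz
      · exact absurd hsy hsz
      · exact hz
    have h2 := (List.pairwise_cons.1 (List.pairwise_append.1 hw.1).2.1).1 z hz'
    exact ⟨z, by simp [hz'], by simpa using hsz, h2, hw.2.2 z (by simp [hz']) x (by simp)⟩

/-- A `-` that is not followed by any `+` survives. -/
theorem minus_mem_red {u v : List α} {x : α} (hx : s x = true) (hv : ∀ y ∈ v, s y = true) :
    x ∈ red s (u ++ x :: v) := by
  have h : ∀ y ∈ x :: v, s y = true := by simpa [hx] using hv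
  obtain ⟨p, n, hr, hp, hn⟩ := red_form (s := s) u
  rw [red_append, red_of_minus h, hr, List.foldr_append, foldr_minus hn h, foldr_plus hp]
  simp

/-! ### Words made of blocks -/

/-- The word with `A j` letters `+` and then `M j` letters `-` of label `j`, for `n` successive
labels `j` starting from `j₀`. -/
def blocks (A M : ℕ → ℕ) : ℕ → ℕ → List (ℕ × Bool)
  | _, 0 => []
  | j, n + 1 => List.replicate (A j) (j, false) ++
      (List.replicate (M j) (j, true) ++ blocks A M (j + 1) n)

/-- The word `-^b +^a` loses equal numbers of both signs, so only the difference `a - b` matters. -/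
theorem red_replicate_cancel (j : ℕ) (w : List (ℕ × Bool)) :
    ∀ a b c d : ℕ, a + d = c + b →
    (List.replicate b (j, true)).foldr (consRed Prod.snd)
      (List.replicate a (j + 1, false) ++ w) =
    (List.replicate d (j, true)).foldr (consRed Prod.snd)
      (List.replicate c (j + 1, false) ++ w) := by
  have step : ∀ a b, (List.replicate (b + 1) (j, true)).foldr (consRed Prod.snd)
      (List.replicate (a + 1) (j + 1, false) ++ w) =
      (List.replicate b (j, true)).foldr (consRed Prod.snd)
      (List.replicate a (j + 1, false) ++ w) := by
    intro a b
    rw [List.replicate_succ' (n := b), List.foldr_append]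
    simp [consRed, List.replicate_succ]
  have many : ∀ t a b, (List.replicate (b + t) (j, true)).foldr (consRed Prod.snd)
      (List.replicate (a + t) (j + 1, false) ++ w) =
      (List.replicate b (j, true)).foldr (consRed Prod.snd)
      (List.replicate a (j + 1, false) ++ w) := by
    intro t
    induction t with
    | zero => intros; rfl
    | succ t ih => intro a b; rw [← add_assoc, ← add_assoc, step, ih]
  intro a b c d h
  rcases le_total a c with hac | hac
  · obtain ⟨t, rfl⟩ := Nat.exists_eq_add_of_le hac
    obtain rfl : d = b + t := by omega
    exact (many t a b).symm
  · obtain ⟨t, rfl⟩ := Nat.exists_eq_add_of_le hac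
    obtain rfl : b = d + t := by omega
    exact many t c d

/-- Regroup the word so that the `-`'s of label `j` stand together with the `+`'s of label `j + 1`;
each such group is governed by a difference. The vanishing at `N` makes the condition for the last
label say that its `-`'s are equally many. -/
theorem red_blocks_eq {A M A' M' : ℕ → ℕ} (h0 : A 0 = A' 0)
    (h : ∀ j, A (j + 1) + M' j = A' (j + 1) + M j) {N : ℕ} (hN : A N = 0) (hN' : A' N = 0) :
    red Prod.snd (blocks A M 0 N) = red Prod.snd (blocks A' M' 0 N) := by
  have plus : ∀ a j (w : List (ℕ × Bool)), red Prod.snd (List.replicate a (j, false) ++ w) =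
      List.replicate a (j, false) ++ red Prod.snd w := by
    intro a j w
    have : ∀ x ∈ List.replicate a (j, false), Prod.snd x = false := by
      intro x hx; rw [List.eq_of_mem_replicate hx]
    rw [red_append, red_of_plus this, foldr_plus this]
  have minus : ∀ a j (w : List (ℕ × Bool)), red Prod.snd (List.replicate a (j, true) ++ w) =
      (List.replicate a (j, true)).foldr (consRed Prod.snd) (red Prod.snd w) := by
    intro a j w
    rw [red, List.foldr_append]; rfl
  have key : ∀ n j, j + n + 1 = N →
      red Prod.snd (List.replicate (M j) (j, true) ++ blocks A M (j + 1) n) =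
      red Prod.snd (List.replicate (M' j) (j, true) ++ blocks A' M' (j + 1) n) := by
    intro n
    induction n with
    | zero =>
      intro j hj
      have := h j
      rw [show j + 1 = N from by omega, hN, hN'] at this
      rw [show M j = M' j by omega]
      rfl
    | succ n ih =>
      intro j hj
      rw [blocks, blocks, minus, minus, plus, plus, ih (j + 1) (by omega)]
      exact red_replicate_cancel _ _ _ _ _ _ (h j)
  cases N with
  | zero => rfl
  | succ N => rw [blocks, blocks, plus, plus, key N 0 (by omega), h0]

/-- Labels are compared first; for equal labels `+` comes before `-`. -/
def LabelLE (x y : ℕ × Bool) : Prop := x.1 < y.1 ∨ x.1 = y.1 ∧ (x.2 = true → y.2 = true)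

theorem le_of_mem_blocks {A M : ℕ → ℕ} {n : ℕ} :
    ∀ {j : ℕ} {x : ℕ × Bool}, x ∈ blocks A M j n → j ≤ x.1 := by
  induction n with
  | zero => intro j x h; simp [blocks] at h
  | succ n ih =>
    intro j x h
    simp only [blocks, List.mem_append] at h
    rcases h with h | h | h
    · rw [List.eq_of_mem_replicate h]
    · rw [List.eq_of_mem_replicate h]
    · have := ih h; omega

theorem pairwise_blocks (A M : ℕ → ℕ) (n : ℕ) :
    ∀ j : ℕ, (blocks A M j n).Pairwise LabelLE := by
  induction n with
  | zero => intro j; simp [blocks]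
  | succ n ih =>
    intro j
    simp only [blocks, List.pairwise_append, List.pairwise_replicate, List.mem_append]
    refine ⟨Or.inr (Or.inr ⟨rfl, by simp⟩), ⟨Or.inr (Or.inr ⟨rfl, by simp⟩), ih _, ?_⟩, ?_⟩
    · intro x hx y hy
      rw [List.eq_of_mem_replicate hx]
      exact Or.inl (le_of_mem_blocks hy)
    · rintro x hx y (hy | hy)
      · rw [List.eq_of_mem_replicate hx, List.eq_of_mem_replicate hy]
        exact Or.inr ⟨rfl, by simp⟩
      · rw [List.eq_of_mem_replicate hx]
        exact Or.inl (le_of_mem_blocks hy)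

theorem count_blocks (A M : ℕ → ℕ) (n : ℕ) (x : ℕ × Bool) :
    ∀ j : ℕ, (blocks A M j n).count x =
      if j ≤ x.1 ∧ x.1 < j + n then (if x.2 then M x.1 else A x.1) else 0 := by
  obtain ⟨k, e⟩ := x
  induction n with
  | zero => intro j; simp [blocks]
  | succ n ih =>
    intro j
    rw [blocks, List.count_append, List.count_append, ih, List.count_replicate,
      List.count_replicate]
    rcases lt_trichotomy k j with h | rfl | h
    · cases e <;> simp [h.ne', show ¬ j + 1 ≤ k by omega, show ¬ j ≤ k by omega]
    · cases e <;> simp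
    · cases e <;>
      simp [h.ne, show j + 1 ≤ k by omega, show j ≤ k by omega, add_assoc, add_comm 1 n]

theorem eq_blocks {w : List (ℕ × Bool)} (hw : w.Pairwise LabelLE) {N : ℕ}
    (hN : ∀ x ∈ w, x.1 < N) :
    w = blocks (fun j => w.count (j, false)) (fun j => w.count (j, true)) 0 N := by
  refine List.Perm.eq_of_pairwise (le := LabelLE) ?_ hw (pairwise_blocks _ _ _ _)
    (List.perm_iff_count.2 fun x => ?_)
  · rintro ⟨a, b⟩ ⟨c, d⟩ - - h h'
    simp only [LabelLE] at h h'
    obtain rfl : a = c := by omega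
    have : b = true ↔ d = true := ⟨by simpa using h, by simpa using h'⟩
    rw [Bool.eq_iff_iff.2 this]
  · rw [count_blocks]
    obtain ⟨k, e⟩ := x
    by_cases hk : k < N
    · cases e <;> simp [hk]
    · rw [List.count_eq_zero_of_not_mem fun h => hk (hN _ h)]
      simp [hk]

/-- Two sorted words have the same reduction if, for every `j`, they agree in the number of
`+`'s of label `j + 1` minus the number of `-`'s of label `j`. -/
theorem red_eq_of_count {w w' : List (ℕ × Bool)} (hw : w.Pairwise LabelLE)
    (hw' : w'.Pairwise LabelLE) (h0 : w.count (0, false) = w'.count (0, false))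
    (h : ∀ j, w.count (j + 1, false) + w'.count (j, true) =
      w'.count (j + 1, false) + w.count (j, true)) :
    red Prod.snd w = red Prod.snd w' := by
  obtain ⟨N, hN⟩ : ∃ N, ∀ x ∈ w ++ w', x.1 < N := by
    refine ⟨((w ++ w').map Prod.fst).sum + 1, fun x hx => Nat.lt_succ_of_le ?_⟩
    exact List.single_le_sum (by simp) _ (List.mem_map_of_mem hx)
  have hw1 : ∀ x ∈ w, x.1 < N := fun x hx => hN x (by simp [hx])
  have hw2 : ∀ x ∈ w', x.1 < N := fun x hx => hN x (by simp [hx])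
  rw [eq_blocks hw hw1, eq_blocks hw' hw2]
  refine red_blocks_eq (A := fun j => w.count (j, false)) (A' := fun j => w'.count (j, false))
    h0 h (List.count_eq_zero_of_not_mem fun hx => ?_)
    (List.count_eq_zero_of_not_mem fun hx => ?_)
  · exact lt_irrefl N (hw1 _ hx)
  · exact lt_irrefl N (hw2 _ hx)

end Words

/-! ### Rows and columns of diagrams -/

section Diagrams

variable {μ : YoungDiagram} {a b p q : ℕ}

theorem rowLen_eq_of {n : ℕ} (h : ∀ b, (a, b) ∈ μ ↔ b < n) : μ.rowLen a = n := by
  have h1 := h n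
  have h2 := h (n - 1)
  rw [YoungDiagram.mem_iff_lt_rowLen] at h1 h2
  omega

theorem colLen_eq_of {n : ℕ} (h : ∀ a, (a, b) ∈ μ ↔ a < n) : μ.colLen b = n := by
  have h1 := h n
  have h2 := h (n - 1)
  rw [YoungDiagram.mem_iff_lt_colLen] at h1 h2
  omega

theorem lt_rowLen_iff : b < μ.rowLen a ↔ a < μ.colLen b := by
  rw [← YoungDiagram.mem_iff_lt_rowLen, YoungDiagram.mem_iff_lt_colLen]

theorem isAddable_iff : IsAddable μ (a, b) ↔ μ.rowLen a = b ∧ μ.colLen b = a := by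
  constructor
  · rintro ⟨h1, h2⟩
    have h3 := h1
    rw [YoungDiagram.mem_iff_lt_rowLen] at h1
    rw [YoungDiagram.mem_iff_lt_colLen] at h3
    constructor
    · rcases b with _ | b
      · omega
      · have h4 : (a, b) ∈ (↑(insert (a, b + 1) μ.cells) : Set (ℕ × ℕ)) :=
          h2 (a := (a, b + 1)) (by simp) (by simp)
        have h5 : (a, b) ∈ μ := by simpa using h4
        rw [YoungDiagram.mem_iff_lt_rowLen] at h5
        omega
    · rcases a with _ | a
      · omega
      · have h4 : (a, b) ∈ (↑(insert (a + 1, b) μ.cells) : Set (ℕ × ℕ)) :=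
          h2 (a := (a + 1, b)) (by simp) (by simp)
        have h5 : (a, b) ∈ μ := by simpa using h4
        rw [YoungDiagram.mem_iff_lt_colLen] at h5
        omega
  · rintro ⟨h1, h2⟩
    refine ⟨by rw [YoungDiagram.mem_iff_lt_rowLen]; omega, ?_⟩
    rintro ⟨c, d⟩ ⟨c', d'⟩ ⟨hc, hd⟩ h
    simp only [Finset.coe_insert, Set.mem_insert_iff, Finset.mem_coe, YoungDiagram.mem_cells] at *
    rcases h with h | h
    · simp only [Prod.mk.injEq] at h hc hd ⊢
      by_cases hb : d' < b
      · right
        apply μ.up_left_mem (show c' ≤ a by omega) le_rfl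
        rw [YoungDiagram.mem_iff_lt_rowLen]; omega
      · by_cases ha : c' < a
        · right
          apply μ.up_left_mem le_rfl (show d' ≤ b by omega)
          rw [YoungDiagram.mem_iff_lt_colLen]; omega
        · left; omega
    · exact Or.inr (μ.up_left_mem hc hd h)

theorem isRemovable_iff : IsRemovable μ (a, b) ↔ μ.rowLen a = b + 1 ∧ μ.colLen b = a + 1 := by
  constructor
  · rintro ⟨h1, h2⟩
    have h3 := h1
    rw [YoungDiagram.mem_iff_lt_rowLen] at h1
    rw [YoungDiagram.mem_iff_lt_colLen] at h3
    have key : ∀ c d, (c, d) ≠ (a, b) → a ≤ c → b ≤ d → (c, d) ∉ μ := by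
      intro c d hne hc hd hμ
      have h4 : (a, b) ∈ (↑(μ.cells.erase (a, b)) : Set (ℕ × ℕ)) :=
        h2 (a := (c, d)) ⟨hc, hd⟩ (by simp [hμ]; simpa using hne)
      simp at h4
    have k1 := key a (b + 1) (by simp) le_rfl (by omega)
    have k2 := key (a + 1) b (by simp) (by omega) le_rfl
    rw [YoungDiagram.mem_iff_lt_rowLen] at k1
    rw [YoungDiagram.mem_iff_lt_colLen] at k2
    omega
  · rintro ⟨h1, h2⟩
    refine ⟨by rw [YoungDiagram.mem_iff_lt_rowLen]; omega, ?_⟩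
    rintro ⟨c, d⟩ ⟨c', d'⟩ ⟨hc, hd⟩ h
    simp only [Finset.coe_erase, Set.mem_sdiff, Set.mem_singleton_iff, Finset.mem_coe,
      YoungDiagram.mem_cells, Prod.mk.injEq] at *
    refine ⟨μ.up_left_mem hc hd h.1, ?_⟩
    rintro ⟨rfl, rfl⟩
    have k1 := YoungDiagram.mem_iff_lt_rowLen.1 (μ.up_left_mem hc le_rfl h.1)
    have k2 := YoungDiagram.mem_iff_lt_colLen.1 (μ.up_left_mem le_rfl hd h.1)
    omega

theorem mem_addBox {x y : ℕ × ℕ} (h : IsAddable μ x) :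
    y ∈ addBox μ x h ↔ y = x ∨ y ∈ μ := by
  rw [← YoungDiagram.mem_cells, addBox]; simp

theorem mem_removeBox {x y : ℕ × ℕ} (h : IsRemovable μ x) :
    y ∈ removeBox μ x h ↔ y ≠ x ∧ y ∈ μ := by
  rw [← YoungDiagram.mem_cells, removeBox]; simp

theorem rowLen_addBox (h : IsAddable μ (p, q)) (a : ℕ) :
    (addBox μ (p, q) h).rowLen a = if a = p then q + 1 else μ.rowLen a := by
  have h' := isAddable_iff.1 h
  apply rowLen_eq_of
  intro b
  rw [mem_addBox, YoungDiagram.mem_iff_lt_rowLen, Prod.mk.injEq]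
  split_ifs with ha
  · subst ha; omega
  · omega

theorem colLen_addBox (h : IsAddable μ (p, q)) (b : ℕ) :
    (addBox μ (p, q) h).colLen b = if b = q then p + 1 else μ.colLen b := by
  have h' := isAddable_iff.1 h
  apply colLen_eq_of
  intro a
  rw [mem_addBox, YoungDiagram.mem_iff_lt_colLen, Prod.mk.injEq]
  split_ifs with hb
  · subst hb; omega
  · omega

theorem rowLen_removeBox (h : IsRemovable μ (p, q)) (a : ℕ) :
    (removeBox μ (p, q) h).rowLen a = if a = p then q else μ.rowLen a := by
  have h' := isRemovable_iff.1 h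
  apply rowLen_eq_of
  intro b
  rw [mem_removeBox, YoungDiagram.mem_iff_lt_rowLen, Ne, Prod.mk.injEq]
  split_ifs with ha
  · subst ha; omega
  · omega

theorem colLen_removeBox (h : IsRemovable μ (p, q)) (b : ℕ) :
    (removeBox μ (p, q) h).colLen b = if b = q then p else μ.colLen b := by
  have h' := isRemovable_iff.1 h
  apply colLen_eq_of
  intro a
  rw [mem_removeBox, YoungDiagram.mem_iff_lt_colLen, Ne, Prod.mk.injEq]
  split_ifs with hb
  · subst hb; omega
  · omega

theorem isAddable_removeBox {x : ℕ × ℕ} (h : IsRemovable μ x) : IsAddable (removeBox μ x h) x := by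
  obtain ⟨p, q⟩ := x
  rw [isAddable_iff, rowLen_removeBox, colLen_removeBox]
  simp

theorem addBox_removeBox {x : ℕ × ℕ} (h : IsRemovable μ x)
    (h' : IsAddable (removeBox μ x h) x) : addBox (removeBox μ x h) x h' = μ := by
  ext y
  rw [YoungDiagram.mem_cells, YoungDiagram.mem_cells, mem_addBox, mem_removeBox]
  by_cases hy : y = x
  · simp [hy, h.1]
  · simp [hy]

end Diagrams

/-! ### Residues -/

section Residues

variable {ℓ : ℕ}

theorem residue_eq_iff {x y : ℕ × ℕ} :
    residue ℓ x = residue ℓ y ↔ x.2 + y.1 ≡ y.2 + x.1 [MOD ℓ] := by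
  rw [← ZMod.natCast_eq_natCast_iff, residue, residue, sub_eq_sub_iff_add_eq_add]
  push_cast
  rfl

theorem eq_of_modEq {a b : ℕ} (h : a ≡ b [MOD ℓ]) (h1 : a < b + ℓ) (h2 : b < a + ℓ) : a = b := by
  rcases le_total a b with hab | hab
  · have := Nat.eq_zero_of_dvd_of_lt ((Nat.modEq_iff_dvd' hab).1 h) (by omega)
    omega
  · have := Nat.eq_zero_of_dvd_of_lt ((Nat.modEq_iff_dvd' hab).1 h.symm) (by omega)
    omega

/-- Modulo `ℓ` the factor `ℓ - 1` is `-1`. So residues are constant on ladders, and ladders of equal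
residue have numbers differing by multiples of `ℓ`. -/
theorem residue_eq_ladderIndex (hℓ : 2 < ℓ) (x : ℕ × ℕ) :
    residue ℓ x = -(ladderIndex ℓ x : ZMod ℓ) := by
  rw [residue, ladderIndex]
  push_cast [Nat.cast_sub (show 1 ≤ ℓ by omega), ZMod.natCast_self]
  ring

theorem ladderIndex_modEq (hℓ : 2 < ℓ) {x y : ℕ × ℕ} (h : residue ℓ x = residue ℓ y) :
    ladderIndex ℓ x ≡ ladderIndex ℓ y [MOD ℓ] := by
  rw [residue_eq_ladderIndex hℓ, residue_eq_ladderIndex hℓ, neg_inj] at h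
  exact (ZMod.natCast_eq_natCast_iff _ _ _).1 h

theorem ladderIndex_eq (hℓ : 2 < ℓ) {x y : ℕ × ℕ} (h : residue ℓ x = residue ℓ y)
    (h1 : ladderIndex ℓ x < ladderIndex ℓ y + ℓ) (h2 : ladderIndex ℓ y < ladderIndex ℓ x + ℓ) :
    ladderIndex ℓ x = ladderIndex ℓ y :=
  eq_of_modEq (ladderIndex_modEq hℓ h) h1 h2

theorem ladderIndex_eq_of_le (hℓ : 2 < ℓ) {x y : ℕ × ℕ} (h : residue ℓ x = residue ℓ y)
    (h1 : ladderIndex ℓ x ≤ ladderIndex ℓ y) (h2 : ladderIndex ℓ y ≤ ladderIndex ℓ x + ℓ) :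
    ladderIndex ℓ x = ladderIndex ℓ y ∨ ladderIndex ℓ y = ladderIndex ℓ x + ℓ := by
  by_cases h3 : ladderIndex ℓ y = ladderIndex ℓ x + ℓ
  · exact Or.inr h3
  · exact Or.inl (ladderIndex_eq hℓ h (by omega) (by omega))

theorem residue_of_ladderIndex (hℓ : 2 < ℓ) {x y : ℕ × ℕ}
    (h : ladderIndex ℓ x ≡ ladderIndex ℓ y [MOD ℓ]) : residue ℓ x = residue ℓ y := by
  rw [residue_eq_ladderIndex hℓ, residue_eq_ladderIndex hℓ, neg_inj]
  exact (ZMod.natCast_eq_natCast_iff _ _ _).2 h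

end Residues

/-! ### Crystal operators in terms of pivots -/

section Operators

/-- True on the letters `-`. -/
def sgn (μ : YoungDiagram) (x : ℕ × ℕ) : Bool := decide (x ∈ μ)

variable {μ ν : YoungDiagram} {w : List (ℕ × ℕ)}

theorem reduceWord_eq_red (μ : YoungDiagram) (w : List (ℕ × ℕ)) :
    reduceWord μ w = red (sgn μ) w := by
  induction w with
  | nil => rfl
  | cons x w ih =>
    rw [red_cons, ← ih]
    change consCancel μ x (reduceWord μ w) = _
    cases reduceWord μ w with
    | nil => rfl
    | cons y u => simp [consCancel, consRed, sgn]

theorem normalBoxes_eq : normalBoxes μ w = (red (sgn μ) w).filter (sgn μ) := by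
  rw [normalBoxes, reduceWord_eq_red]; rfl

theorem conormalBoxes_eq : conormalBoxes μ w = (red (sgn μ) w).filter fun x => !sgn μ x := by
  rw [conormalBoxes, reduceWord_eq_red]; simp [sgn]

theorem fOfWord_eq_some_iff (hw : w.Nodup) :
    fOfWord μ w = some ν ↔
      ∃ x, ∃ h : IsAddable μ x, IsPivot (sgn μ) w x ∧ addBox μ x h = ν := by
  simp only [fOfWord, Option.bind_eq_some_iff, conormalBoxes_eq, getLast?_plus_iff hw]
  constructor
  · rintro ⟨x, ⟨-, hx⟩, h⟩
    split_ifs at h with h'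
    exact ⟨x, h', hx, Option.some.inj h⟩
  · rintro ⟨x, h, hx, rfl⟩
    exact ⟨x, ⟨by simp [sgn, h.1], hx⟩, by rw [dif_pos h]⟩

theorem eOfWord_eq_some_iff (hw : w.Nodup) :
    eOfWord μ w = some ν ↔
      ∃ x, ∃ h : IsRemovable μ x, IsPivot (sgn μ) w x ∧ removeBox μ x h = ν := by
  simp only [eOfWord, Option.bind_eq_some_iff, normalBoxes_eq, head?_minus_iff hw]
  constructor
  · rintro ⟨x, ⟨-, hx⟩, h⟩
    split_ifs at h with h'
    exact ⟨x, h', hx, Option.some.inj h⟩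
  · rintro ⟨x, h, hx, rfl⟩
    exact ⟨x, ⟨by simp [sgn, h.1], hx⟩, by rw [dif_pos h]⟩

section ListBy

variable {α : Type} [LinearOrder α] {key : ℕ × ℕ → α} {hkey : Function.Injective key}
  {s : Finset (ℕ × ℕ)}

theorem mem_listBy {x : ℕ × ℕ} : x ∈ listBy key hkey s ↔ x ∈ s := by
  simp [listBy]

theorem nodup_listBy : (listBy key hkey s).Nodup := by
  simp [listBy]

theorem pairwise_listBy : (listBy key hkey s).Pairwise fun x y => key x < key y := by
  have h1 : (listBy key hkey s).Pairwise fun x y => key x ≤ key y := by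
    have : Std.Antisymm fun x y : ℕ × ℕ => key x ≤ key y :=
      ⟨fun _ _ h h' => hkey (le_antisymm h h')⟩
    have : Std.Total fun x y : ℕ × ℕ => key x ≤ key y := ⟨fun _ _ => le_total _ _⟩
    have : IsTrans (ℕ × ℕ) fun x y => key x ≤ key y := ⟨fun _ _ _ => le_trans⟩
    exact Finset.pairwise_sort s fun x y => key x ≤ key y
  exact (h1.and (nodup_listBy (hkey := hkey))).imp fun {x y} h =>
    lt_of_le_of_ne h.1 fun h' => h.2 (hkey h')

end ListBy

theorem isAddable_of_mem_signedBoxes {ℓ : ℕ} {i : ZMod ℓ} {x : ℕ × ℕ}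
    (h : x ∈ signedBoxes ℓ i μ) (hx : sgn μ x = false) : IsAddable μ x := by
  rcases (mem_signedBoxes.1 h).1 with h | h
  · exact h
  · simp [sgn, h.1] at hx

theorem isRemovable_of_mem_signedBoxes {ℓ : ℕ} {i : ZMod ℓ} {x : ℕ × ℕ}
    (h : x ∈ signedBoxes ℓ i μ) (hx : sgn μ x = true) : IsRemovable μ x := by
  rcases (mem_signedBoxes.1 h).1 with h | h
  · simp [sgn, h.1] at hx
  · exact h

/-- Apart from `x`, only neighbours of `x` can gain or lose a sign, and their residues differ from
that of `x`. The box `x` itself just changes from `-` to `+`. -/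
theorem signedBoxes_removeBox {ℓ : ℕ} (hℓ : 2 < ℓ) {x : ℕ × ℕ} (h : IsRemovable μ x) :
    signedBoxes ℓ (residue ℓ x) (removeBox μ x h) = signedBoxes ℓ (residue ℓ x) μ := by
  obtain ⟨p, q⟩ := x
  ext ⟨a, b⟩
  rw [mem_signedBoxes, mem_signedBoxes]
  refine and_congr_left fun hr => ?_
  have h' := isRemovable_iff.1 h
  rw [residue_eq_iff] at hr
  simp only [isAddable_iff, isRemovable_iff, rowLen_removeBox, colLen_removeBox]
  by_cases ha : a = p
  · subst ha
    by_cases hb : b = q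
    · subst hb; simp; omega
    · have : ¬ (b + a < q + a + ℓ ∧ q + a < b + a + ℓ) := fun h =>
        hb (by have := eq_of_modEq hr h.1 h.2; omega)
      simp only [if_true, if_neg hb]
      omega
  · by_cases hb : b = q
    · subst hb
      have : ¬ (b + p < b + a + ℓ ∧ b + a < b + p + ℓ) := fun h =>
        ha (by have := eq_of_modEq hr h.1 h.2; omega)
      simp only [if_true, if_neg ha]
      omega
    · simp only [if_neg ha, if_neg hb]

/-- `f_i e_i μ = μ`, for any reading order. -/
theorem f_of_e {ℓ : ℕ} (hℓ : 2 < ℓ) {α : Type} [LinearOrder α] {key : ℕ × ℕ → α}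
    {hkey : Function.Injective key} {i : ZMod ℓ}
    (h : eOfWord μ (listBy key hkey (signedBoxes ℓ i μ)) = some ν) :
    fOfWord ν (listBy key hkey (signedBoxes ℓ i ν)) = some μ := by
  rw [eOfWord_eq_some_iff nodup_listBy] at h
  obtain ⟨x, hx, ⟨u, v, hw, hu, hv⟩, rfl⟩ := h
  have hxi : residue ℓ x = i := by
    have : x ∈ listBy key hkey (signedBoxes ℓ i μ) := by rw [hw]; simp
    exact (mem_signedBoxes.1 (mem_listBy.1 this)).2
  subst hxi
  rw [fOfWord_eq_some_iff nodup_listBy]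
  refine ⟨x, isAddable_removeBox hx, ⟨u, v, ?_⟩, addBox_removeBox _ _⟩
  have hnd : (u ++ x :: v).Nodup := by rw [← hw]; exact nodup_listBy
  have hnd := List.nodup_middle.1 hnd
  rw [List.nodup_cons, List.mem_append, not_or] at hnd
  -- Only the sign of `x` flips, and the pivot condition ignores that sign, so `x` stays the pivot.
  have hs : ∀ y, y ≠ x → sgn (removeBox μ x hx) y = sgn μ y := by
    intro y hy
    simp [sgn, mem_removeBox, hy]
  have hsu : ∀ y ∈ u, sgn (removeBox μ x hx) y = sgn μ y := fun y hy =>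
    hs y (by rintro rfl; exact hnd.1.1 hy)
  have hsv : ∀ y ∈ v, sgn (removeBox μ x hx) y = sgn μ y := fun y hy =>
    hs y (by rintro rfl; exact hnd.1.2 hy)
  rw [signedBoxes_removeBox hℓ, red_congr hsu, red_congr hsv]
  exact ⟨hw, fun y hy => by rw [hsu y ((red_sublist u).subset hy)]; exact hu y hy,
    fun y hy => by rw [hsv y ((red_sublist v).subset hy)]; exact hv y hy⟩

end Operators

/-! ### Invariance of the defining conditions -/

section Invariance

variable {ℓ : ℕ} {μ : YoungDiagram}

theorem ladderKey_lt_iff (hℓ : 2 < ℓ) {x y : ℕ × ℕ} :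
    ladderKey ℓ x < ladderKey ℓ y ↔ ladderIndex ℓ x < ladderIndex ℓ y ∨
      ladderIndex ℓ x = ladderIndex ℓ y ∧ x.1 < y.1 := by
  rw [ladderKey, ladderKey, Prod.Lex.toLex_lt_toLex]
  simp only [Prod.Lex.toLex_lt_toLex]
  constructor
  · rintro (h | ⟨h, h' | ⟨h1, h2⟩⟩)
    · exact Or.inl h
    · exact Or.inr ⟨h, h'⟩
    · exfalso
      simp only [ladderIndex, h1] at h
      have := Nat.eq_of_mul_eq_mul_left (show 0 < ℓ - 1 by omega) (Nat.add_left_cancel h)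
      omega
  · rintro (h | ⟨h, h'⟩)
    · exact Or.inl h
    · exact Or.inr ⟨h, Or.inl h'⟩

theorem rowKey_lt_iff {x y : ℕ × ℕ} :
    rowKey x < rowKey y ↔ y.1 < x.1 ∨ x.1 = y.1 ∧ x.2 < y.2 := by
  rw [rowKey, rowKey, Prod.Lex.toLex_lt_toLex]
  simp

/-! ### Matched signs on either side of a pivot -/

section Matching

variable {α : Type} [LinearOrder α] {key : ℕ × ℕ → α} {hkey : Function.Injective key}
  {i : ZMod ℓ} {x y : ℕ × ℕ}

theorem IsPivot.exists_removable
    (hx : IsPivot (sgn μ) (listBy key hkey (signedBoxes ℓ i μ)) x) (hy : IsAddable μ y)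
    (hr : residue ℓ y = i) (hxy : key x < key y) :
    ∃ z, IsRemovable μ z ∧ residue ℓ z = i ∧ key x < key z ∧ key z < key y := by
  obtain ⟨z, hz, hs, h⟩ := hx.exists_minus pairwise_listBy
    (mem_listBy.2 (mem_signedBoxes.2 ⟨Or.inl hy, hr⟩)) (by simp [sgn, hy.1]) hxy
  rw [mem_listBy] at hz
  exact ⟨z, isRemovable_of_mem_signedBoxes hz hs, (mem_signedBoxes.1 hz).2, h⟩

theorem IsPivot.exists_addable
    (hx : IsPivot (sgn μ) (listBy key hkey (signedBoxes ℓ i μ)) x) (hy : IsRemovable μ y)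
    (hr : residue ℓ y = i) (hxy : key y < key x) :
    ∃ z, IsAddable μ z ∧ residue ℓ z = i ∧ key y < key z ∧ key z < key x := by
  obtain ⟨z, hz, hs, h⟩ := hx.exists_plus pairwise_listBy
    (mem_listBy.2 (mem_signedBoxes.2 ⟨Or.inr hy, hr⟩)) (by simp [sgn, hy.1]) hxy
  rw [mem_listBy] at hz
  exact ⟨z, isAddable_of_mem_signedBoxes hz hs, (mem_signedBoxes.1 hz).2, h⟩

end Matching

/-- No box of the diagram has a leg of length `(ℓ - 1) * arm - 1`: the first position to the right
of its row is never `ℓ - 1` ladders after the first position below its column. -/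
def NoBalancedHook (ℓ : ℕ) (μ : YoungDiagram) : Prop :=
  ∀ a d, (a, d) ∈ μ →
    a + (ℓ - 1) * μ.rowLen a ≠ μ.colLen d + (ℓ - 1) * d + (ℓ - 1)

/-- On each ladder the boxes of the diagram are at the top. -/
def IsTopJustified (ℓ : ℕ) (μ : YoungDiagram) : Prop :=
  ∀ a b, (a + (ℓ - 1), b) ∈ μ → (a, b + 1) ∈ μ

theorem noBalancedHook_bot : NoBalancedHook ℓ ⊥ := fun _ _ h =>
  absurd h (YoungDiagram.notMem_bot _)

theorem residue_eq_of_ladderIndex_add (hℓ : 2 < ℓ) {x y : ℕ × ℕ}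
    (h : ladderIndex ℓ y = ladderIndex ℓ x + ℓ) : residue ℓ y = residue ℓ x := by
  apply residue_of_ladderIndex hℓ
  rw [h]
  simp [Nat.ModEq]

theorem residue_eq_of_ladderIndex_eq (hℓ : 2 < ℓ) {x y : ℕ × ℕ}
    (h : ladderIndex ℓ y = ladderIndex ℓ x) : residue ℓ y = residue ℓ x :=
  residue_of_ladderIndex hℓ (by rw [h])

/-- A new balanced hook must use the enlarged row or column of `x`. Its other end is then an addable
box of the same residue read after `x`, or `μ` already has a balanced hook. Since `x` is a pivot, a
removable box lies in between, and it completes a balanced hook of `μ`. -/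
theorem NoBalancedHook.addBox (hℓ : 2 < ℓ) (hμ : NoBalancedHook ℓ μ) {x : ℕ × ℕ}
    (h : IsAddable μ x) (hx : IsPivot (sgn μ) (ladderSignature ℓ (residue ℓ x) μ) x) :
    NoBalancedHook ℓ (addBox μ x h) := by
  obtain ⟨p, q⟩ := x
  obtain ⟨hp, hq⟩ := isAddable_iff.1 h
  obtain ⟨m, hm⟩ : ∃ m, ℓ - 1 = m := ⟨_, rfl⟩
  have hℓm : ℓ = m + 1 := by omega
  rintro a d had heq
  have hbad := hμ
  rw [mem_addBox, Prod.mk.injEq] at had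
  rw [rowLen_addBox, colLen_addBox] at heq
  simp only [NoBalancedHook, hm] at heq hbad
  by_cases ha : a = p
  · subst ha
    by_cases hd : d = q
    · subst hd; simp only [if_true, mul_add] at heq; omega
    · have had' : (a, d) ∈ μ := had.resolve_left fun h => hd h.2
      have hdq := YoungDiagram.mem_iff_lt_rowLen.1 had'
      have hac := YoungDiagram.mem_iff_lt_colLen.1 had'
      simp only [if_true, if_neg hd, mul_add, mul_one] at heq
      obtain ⟨c, hc⟩ : ∃ c, μ.colLen d = c := ⟨_, rfl⟩
      rw [hc] at heq hac
      have hcd : μ.rowLen c ≤ d := by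
        have := (lt_rowLen_iff (μ := μ) (a := c) (b := d)).1
        omega
      -- The lengthened row ends at `x`, on the ladder of the position `(c, d)` below column `d`. If
      -- this position is addable, the removable box between the two ends a row that is balanced
      -- against column `d`.
      by_cases hcd' : μ.rowLen c = d
      · obtain ⟨⟨e, f⟩, hz, hzr, h1, h2⟩ := hx.exists_removable
          (isAddable_iff.2 ⟨hcd', hc⟩)
          (residue_eq_of_ladderIndex_eq hℓ (by simp only [ladderIndex, hm]; omega))
          ((ladderKey_lt_iff hℓ).2 (Or.inr ⟨by simp only [ladderIndex, hm]; omega, hac⟩))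
        rw [ladderKey_lt_iff hℓ] at h1 h2
        simp only [ladderIndex, hm] at h1 h2
        obtain ⟨h3, h4⟩ := isRemovable_iff.1 hz
        refine hbad e d (YoungDiagram.mem_iff_lt_colLen.2 (by omega)) ?_
        rw [h3, hc, mul_add]
        omega
      -- Here column `d - 1` has the same length `c`, and the old row `a` is balanced against it.
      · obtain ⟨g, rfl⟩ : ∃ g, d = g + 1 := ⟨d - 1, by omega⟩
        have h1 := μ.colLen_anti g (g + 1) (by omega)
        have h2 := (lt_rowLen_iff (μ := μ) (a := c) (b := g)).2
        refine hbad a g (YoungDiagram.mem_iff_lt_colLen.2 (by omega)) ?_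
        rw [hp, show μ.colLen g = c by omega]
        rw [mul_add] at heq
        omega
  · by_cases hd : d = q
    · subst hd
      have had' : (a, d) ∈ μ := had.resolve_left fun h => ha h.1
      have hdr := YoungDiagram.mem_iff_lt_rowLen.1 had'
      have hap := YoungDiagram.mem_iff_lt_colLen.1 had'
      simp only [if_true, if_neg ha] at heq
      obtain ⟨r, hr⟩ : ∃ r, μ.rowLen a = r := ⟨_, rfl⟩
      rw [hr] at heq hdr
      -- Otherwise the row above also has length `r`, and it is balanced in `μ` against column `d`,
      -- which is one box shorter there.
      have har : μ.colLen r = a := by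
        have h1 := (lt_rowLen_iff (μ := μ) (a := a) (b := r)).2
        rcases a with _ | a
        · omega
        · have h2 := μ.rowLen_anti a (a + 1) (by omega)
          have h3 : μ.rowLen a ≠ r := by
            intro h3
            refine hbad a d (YoungDiagram.mem_iff_lt_colLen.2 (by omega)) ?_
            rw [h3, hq]
            omega
          have h4 := (lt_rowLen_iff (μ := μ) (a := a) (b := r)).1 (by omega)
          omega
      obtain ⟨⟨e, f⟩, hz, hzr, h1, h2⟩ := hx.exists_removable
          (isAddable_iff.2 ⟨hr, har⟩)
          (residue_eq_of_ladderIndex_add hℓ (by simp only [ladderIndex, hm]; omega))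
          ((ladderKey_lt_iff hℓ).2 (Or.inl (by simp only [ladderIndex, hm]; omega)))
      rw [ladderKey_lt_iff hℓ] at h1 h2
      have h5 := ladderIndex_eq_of_le hℓ hzr.symm (by omega)
        (by simp only [ladderIndex, hm] at h1 h2 ⊢; omega)
      simp only [ladderIndex, hm] at h1 h2 h5
      obtain ⟨h3, h4⟩ := isRemovable_iff.1 hz
      -- The addable position `(a, r)` is exactly `ℓ` ladders after `x`, so the removable box
      -- between them is on one of these two ladders. On the first, its column is balanced against
      -- row `a`; on the second, its row is balanced against column `r`.
      rcases h5 with h5 | h5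
      · refine hbad a f (YoungDiagram.mem_iff_lt_colLen.2 (by omega)) ?_
        rw [hr, h4]
        omega
      · refine hbad e r (YoungDiagram.mem_iff_lt_colLen.2 (by omega)) ?_
        rw [h3, har, mul_add]
        omega
    · have had' : (a, d) ∈ μ := had.resolve_left fun h => ha h.1
      simp only [if_neg ha, if_neg hd] at heq
      exact hbad a d had' heq

/-- The argument for adding a box with the signs exchanged: a new balanced hook ends at a removable
box read before `x`, and the addable box between it and the pivot completes a balanced hook of `μ`.
-/
theorem NoBalancedHook.removeBox (hℓ : 2 < ℓ) (hμ : NoBalancedHook ℓ μ) {x : ℕ × ℕ}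
    (h : IsRemovable μ x) (hx : IsPivot (sgn μ) (ladderSignature ℓ (residue ℓ x) μ) x) :
    NoBalancedHook ℓ (removeBox μ x h) := by
  obtain ⟨p, q⟩ := x
  obtain ⟨hp, hq⟩ := isRemovable_iff.1 h
  obtain ⟨m, hm⟩ : ∃ m, ℓ - 1 = m := ⟨_, rfl⟩
  have hℓm : ℓ = m + 1 := by omega
  rintro a d had heq
  have hbad := hμ
  rw [mem_removeBox, Ne, Prod.mk.injEq] at had
  obtain ⟨hne, had⟩ := had
  rw [rowLen_removeBox, colLen_removeBox] at heq
  simp only [NoBalancedHook, hm] at heq hbad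
  have hdr := YoungDiagram.mem_iff_lt_rowLen.1 had
  have hac := YoungDiagram.mem_iff_lt_colLen.1 had
  by_cases ha : a = p
  · subst ha
    have hd : d ≠ q := fun hd => hne ⟨rfl, hd⟩
    simp only [if_true, if_neg hd] at heq
    obtain ⟨c, hc⟩ : ∃ c, μ.colLen d = c + 1 := ⟨μ.colLen d - 1, by omega⟩
    rw [hc] at heq hac
    have hcd : μ.rowLen c = d + 1 := by
      have h1 := (lt_rowLen_iff (μ := μ) (a := c) (b := d)).2 (by omega)
      by_contra h2
      have h3 := (lt_rowLen_iff (μ := μ) (a := c) (b := d + 1)).1 (by omega)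
      have h4 := μ.colLen_anti d (d + 1) (by omega)
      refine hbad a (d + 1) (YoungDiagram.mem_iff_lt_colLen.2 (by omega)) ?_
      rw [hp, show μ.colLen (d + 1) = c + 1 by omega, mul_add, mul_add]
      omega
    obtain ⟨⟨e, f⟩, hz, hzr, h1, h2⟩ := hx.exists_addable
      (isRemovable_iff.2 ⟨hcd, hc⟩)
      (residue_eq_of_ladderIndex_add hℓ (by simp only [ladderIndex, hm]; omega)).symm
      ((ladderKey_lt_iff hℓ).2 (Or.inl (by simp only [ladderIndex, hm]; omega)))
    rw [ladderKey_lt_iff hℓ] at h1 h2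
    have h5 := ladderIndex_eq_of_le hℓ hzr (by omega)
      (by simp only [ladderIndex, hm] at h1 h2 ⊢; omega)
    simp only [ladderIndex, hm] at h1 h2 h5
    obtain ⟨h3, h4⟩ := isAddable_iff.1 hz
    rcases h5 with h5 | h5
    · refine hbad e d (YoungDiagram.mem_iff_lt_colLen.2 (by omega)) ?_
      rw [h3, hc]
      omega
    · refine hbad c f (YoungDiagram.mem_iff_lt_colLen.2 (by omega)) ?_
      rw [hcd, h4, mul_add]
      omega
  · by_cases hd : d = q
    · subst hd
      simp only [if_true, if_neg ha] at heq
      obtain ⟨r, hr⟩ : ∃ r, μ.rowLen a = r + 1 := ⟨μ.rowLen a - 1, by omega⟩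
      rw [hr, mul_add] at heq
      have har : μ.colLen r = a + 1 := by
        have h1 := (lt_rowLen_iff (μ := μ) (a := a) (b := r)).1 (by omega)
        by_contra h2
        have h3 := (lt_rowLen_iff (μ := μ) (a := a + 1) (b := r)).2 (by omega)
        have h4 := μ.rowLen_anti a (a + 1) (by omega)
        refine hbad (a + 1) d (YoungDiagram.mem_iff_lt_colLen.2 (by omega)) ?_
        rw [hq, show μ.rowLen (a + 1) = r + 1 by omega, mul_add]
        omega
      obtain ⟨⟨e, f⟩, hz, hzr, h1, h2⟩ := hx.exists_addable
        (isRemovable_iff.2 ⟨hr, har⟩)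
        (residue_eq_of_ladderIndex_eq hℓ (by simp only [ladderIndex, hm]; omega))
        ((ladderKey_lt_iff hℓ).2 (Or.inr ⟨by simp only [ladderIndex, hm]; omega, by
          simp only; omega⟩))
      rw [ladderKey_lt_iff hℓ] at h1 h2
      simp only [ladderIndex, hm] at h1 h2
      obtain ⟨h3, h4⟩ := isAddable_iff.1 hz
      refine hbad a f (YoungDiagram.mem_iff_lt_colLen.2 (by omega)) ?_
      rw [hr, h4, mul_add]
      omega
    · simp only [if_neg ha, if_neg hd] at heq
      exact hbad a d had heq

/-- The condition can fail only if the next position up the ladder of `x` is empty. That position is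
then addable and read after `x`, so a removable box lies between them. The rows strictly between
leave only the end of the row just above `x`, whose residue is wrong. -/
theorem IsTopJustified.addBox (hℓ : 2 < ℓ) (hμ : IsTopJustified ℓ μ) {x : ℕ × ℕ}
    (h : IsAddable μ x) (hx : IsPivot (sgn μ) (signature ℓ (residue ℓ x) μ) x) :
    IsTopJustified ℓ (addBox μ x h) := by
  obtain ⟨p, q⟩ := x
  obtain ⟨hp, hq⟩ := isAddable_iff.1 h
  obtain ⟨m, hm⟩ : ∃ m, ℓ - 1 = m := ⟨_, rfl⟩
  intro a b hab
  have hμ' := hμ a b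
  have hμ2 := hμ a (b - 1)
  have hμ3 := hμ (a - 1) b
  simp only [YoungDiagram.mem_iff_lt_rowLen, rowLen_addBox, hm] at hab hμ' hμ2 hμ3 ⊢
  by_cases ha : a + m = p
  · rw [if_pos ha] at hab
    rw [if_neg (by omega)]
    rw [ha] at hμ' hμ2
    by_contra hcon
    obtain rfl : b = q := by omega
    have har : μ.rowLen a = b + 1 := by
      have := (lt_rowLen_iff (μ := μ) (a := a) (b := b)).2 (by omega)
      omega
    have hac : μ.colLen (b + 1) = a := by
      have h1 := (lt_rowLen_iff (μ := μ) (a := a) (b := b + 1)).2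
      rcases a with _ | a
      · omega
      · have h2 := (lt_rowLen_iff (μ := μ) (a := a + m) (b := b)).2 (by omega)
        have h3 := (lt_rowLen_iff (μ := μ) (a := a) (b := b + 1)).1 (hμ3 h2)
        omega
    obtain ⟨⟨e, f⟩, hz, hzr, h1, h2⟩ := hx.exists_removable
      (isAddable_iff.2 ⟨har, hac⟩)
      (residue_eq_of_ladderIndex_eq hℓ (by simp only [ladderIndex, hm, mul_add]; omega))
      (rowKey_lt_iff.2 (Or.inl (by simp only; omega)))
    rw [rowKey_lt_iff] at h1 h2
    simp only at h1 h2
    obtain ⟨h3, h4⟩ := isRemovable_iff.1 hz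
    by_cases he : e = p
    · subst he; omega
    · have h5 := (lt_rowLen_iff (μ := μ) (a := e) (b := b)).2 (by omega)
      have h6 := μ.rowLen_anti a e (by omega)
      obtain rfl : f = b := by omega
      by_cases he' : e = a
      · omega
      · have := eq_of_modEq (residue_eq_iff.1 hzr) (by simp only; omega) (by simp only; omega)
        simp only at this
        omega
  · rw [if_neg ha] at hab
    have := hμ' hab
    split_ifs with h1
    · subst h1; omega
    · exact this

/-- The condition can fail only if the next position down the ladder of `x` is a box. It is then
removable and read before `x`, so an addable position lies between them. The rows there have equal
length, which puts that position in the column of `x` fewer than `ℓ` rows below `x`, where the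
residue is wrong. -/
theorem IsTopJustified.removeBox (hℓ : 2 < ℓ) (hμ : IsTopJustified ℓ μ) {x : ℕ × ℕ}
    (h : IsRemovable μ x) (hx : IsPivot (sgn μ) (signature ℓ (residue ℓ x) μ) x) :
    IsTopJustified ℓ (removeBox μ x h) := by
  obtain ⟨p, q⟩ := x
  obtain ⟨hp, hq⟩ := isRemovable_iff.1 h
  obtain ⟨m, hm⟩ : ∃ m, ℓ - 1 = m := ⟨_, rfl⟩
  intro a b hab
  have hμ' := hμ a b
  have hμ2 := hμ (a + 1) b
  simp only [YoungDiagram.mem_iff_lt_rowLen, rowLen_removeBox, hm] at hab hμ' hμ2 ⊢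
  by_cases ha : a = p
  · subst ha
    rw [if_neg (by omega)] at hab
    rw [if_pos rfl]
    by_contra hcon
    obtain rfl : q = b + 1 := by have := hμ' hab; omega
    have hr1 : μ.rowLen (a + 1) ≤ b + 1 := by
      have := (lt_rowLen_iff (μ := μ) (a := a + 1) (b := b + 1)).1
      omega
    have har : μ.rowLen (a + m) = b + 1 := by
      have := μ.rowLen_anti (a + 1) (a + m) (by omega)
      omega
    have hac : μ.colLen b = a + m + 1 := by
      have h1 := (lt_rowLen_iff (μ := μ) (a := a + m) (b := b)).1 hab
      by_contra h2
      have h3 := (lt_rowLen_iff (μ := μ) (a := a + 1 + m) (b := b)).2 (by omega)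
      have := hμ2 h3
      omega
    obtain ⟨⟨e, f⟩, hz, hzr, h1, h2⟩ := hx.exists_addable
      (isRemovable_iff.2 ⟨har, hac⟩)
      (residue_eq_of_ladderIndex_eq hℓ (by simp only [ladderIndex, hm, mul_add]; omega))
      (rowKey_lt_iff.2 (Or.inl (by simp only; omega)))
    rw [rowKey_lt_iff] at h1 h2
    simp only at h1 h2
    obtain ⟨h3, h4⟩ := isAddable_iff.1 hz
    by_cases he : e = a
    · subst he; omega
    · have h5 := μ.rowLen_anti (a + 1) e (by omega)
      have h6 := μ.rowLen_anti e (a + m) (by omega)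
      obtain rfl : f = b + 1 := by omega
      have := eq_of_modEq (residue_eq_iff.1 hzr) (by simp only; omega) (by simp only; omega)
      simp only at this
      omega
  · rw [if_neg ha]
    apply hμ'
    split_ifs at hab with h1
    · rw [h1]; omega
    · exact hab

/-! ### Regularity as top-justification -/

theorem count_rowLens (μ : YoungDiagram) (n : ℕ) :
    μ.rowLens.count n = ((Finset.range (μ.colLen 0)).filter fun a => μ.rowLen a = n).card := by
  rw [YoungDiagram.rowLens, List.count_eq_countP, List.countP_map, List.countP_eq_length_filter]
  rfl

/-- A box `(a + (ℓ - 1), b)` without `(a, b + 1)` forces the `ℓ` rows from `a` to `a + (ℓ - 1)` to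
have length `b + 1`, and conversely. -/
theorem isRegular_iff (hℓ : 2 < ℓ) : IsRegular ℓ μ ↔ IsTopJustified ℓ μ := by
  constructor
  · intro h a b hab
    by_contra hab'
    have h1 := h (b + 1) (by omega)
    rw [YoungDiagram.mem_iff_lt_rowLen] at hab hab'
    have h2 : Finset.Icc a (a + (ℓ - 1)) ⊆
        (Finset.range (μ.colLen 0)).filter fun c => μ.rowLen c = b + 1 := by
      intro c hc
      rw [Finset.mem_Icc] at hc
      have h3 := μ.rowLen_anti a c hc.1
      have h4 := μ.rowLen_anti c _ hc.2
      rw [Finset.mem_filter, Finset.mem_range, ← lt_rowLen_iff]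
      omega
    have h3 := Finset.card_le_card h2
    rw [Nat.card_Icc, ← count_rowLens] at h3
    omega
  · intro h n hn
    rw [count_rowLens]
    set s := (Finset.range (μ.colLen 0)).filter fun c => μ.rowLen c = n with hs
    rcases s.eq_empty_or_nonempty with h0 | h0
    · rw [h0]; simp; omega
    · have h1 := Finset.min'_mem s h0
      set a := s.min' h0
      have h2 : s ⊆ Finset.Ico a (a + (ℓ - 1)) := by
        intro c hc
        have h3 := Finset.min'_le s c hc
        rw [Finset.mem_Ico]
        refine ⟨h3, ?_⟩
        by_contra h4
        rw [hs, Finset.mem_filter] at h1 hc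
        have h5 := μ.rowLen_anti (a + (ℓ - 1)) c (by omega)
        have h6 := h a (n - 1)
        rw [YoungDiagram.mem_iff_lt_rowLen, YoungDiagram.mem_iff_lt_rowLen] at h6
        omega
      have h3 := Finset.card_le_card h2
      rw [Nat.card_Ico] at h3
      omega

end Invariance

/-! ### The number of boxes on each ladder -/

section Counting

variable {ℓ : ℕ} {μ ν : YoungDiagram}

/-- The diagrams have the same number of boxes on each ladder. -/
def SameLadders (ℓ : ℕ) (μ ν : YoungDiagram) : Prop :=
  ∀ k, (boxesOn ℓ μ k).card = (boxesOn ℓ ν k).card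

theorem IsTopJustified.iterate (h : IsTopJustified ℓ μ) {a b : ℕ} :
    ∀ t : ℕ, (a + (ℓ - 1) * t, b) ∈ μ → (a, b + t) ∈ μ := by
  intro t
  induction t generalizing b with
  | zero => exact id
  | succ t ih =>
    intro h'
    rw [mul_add, mul_one, ← add_assoc] at h'
    have := ih (h _ _ h')
    rwa [add_assoc, add_comm 1 t] at this

theorem IsTopJustified.mem_of_le (hℓ : 2 < ℓ) (h : IsTopJustified ℓ μ) {x y : ℕ × ℕ}
    (hxy : ladderIndex ℓ x = ladderIndex ℓ y) (hle : x.1 ≤ y.1) (hy : y ∈ μ) : x ∈ μ := by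
  obtain ⟨a, b⟩ := x
  obtain ⟨c, d⟩ := y
  simp only [ladderIndex] at hxy hle
  have hdb : d ≤ b := by
    by_contra hlt
    have := Nat.mul_lt_mul_of_pos_left (show b < d by omega) (show 0 < ℓ - 1 by omega)
    omega
  obtain ⟨t, rfl⟩ := Nat.exists_eq_add_of_le hdb
  apply h.iterate
  rw [mul_add] at hxy
  rwa [show a + (ℓ - 1) * t = c by omega]

theorem IsTopJustified.subset_of_sameLadders (hℓ : 2 < ℓ) (hμ : IsTopJustified ℓ μ)
    (hν : IsTopJustified ℓ ν) (h : SameLadders ℓ μ ν) {x : ℕ × ℕ} (hx : x ∈ μ) : x ∈ ν := by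
  by_contra hx'
  refine (Finset.card_lt_card (Finset.ssubset_iff_subset_ne.2 ⟨?_, ?_⟩)).ne
    (h (ladderIndex ℓ x)).symm
  · intro y hy
    rw [mem_boxesOn] at hy ⊢
    refine ⟨hμ.mem_of_le hℓ hy.2 ?_ hx, hy.2⟩
    by_contra hlt
    exact hx' (hν.mem_of_le hℓ hy.2.symm (by omega) hy.1)
  · intro heq
    have : x ∈ boxesOn ℓ μ (ladderIndex ℓ x) := mem_boxesOn.2 ⟨hx, rfl⟩
    rw [← heq, mem_boxesOn] at this
    exact hx' this.1

theorem IsTopJustified.eq_of_sameLadders (hℓ : 2 < ℓ) (hμ : IsTopJustified ℓ μ)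
    (hν : IsTopJustified ℓ ν) (h : SameLadders ℓ μ ν) : μ = ν := by
  ext x
  rw [YoungDiagram.mem_cells, YoungDiagram.mem_cells]
  exact ⟨hμ.subset_of_sameLadders hℓ hν h, hν.subset_of_sameLadders hℓ hμ fun k => (h k).symm⟩

/-- The rank of an element, the number of elements below it, is a bijection from `T` to the numbers
below `T.card`. Applied to ladders ordered by row, this shows that regularization keeps the ladder
counts. -/
theorem card_filter_rank_lt {α : Type*} [DecidableEq α] (T : Finset α) (g : α → ℕ)
    (hg : Set.InjOn g T) {n : ℕ} (hn : n ≤ T.card) :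
    (T.filter fun x => (T.filter fun y => g y < g x).card < n).card = n := by
  set r : α → ℕ := fun x => (T.filter fun y => g y < g x).card with hr
  have hlt : ∀ x ∈ T, ∀ y, g x < g y → r x < r y := by
    intro x hx y hxy
    apply Finset.card_lt_card
    rw [Finset.ssubset_iff_of_subset]
    · exact ⟨x, by simp [hx, hxy], by simp⟩
    · intro z hz
      rw [Finset.mem_filter] at hz ⊢
      exact ⟨hz.1, hz.2.trans hxy⟩
  have hinj : Set.InjOn r T := by
    intro x hx y hy hxy
    rcases lt_trichotomy (g x) (g y) with h | h | h
    · exact absurd hxy (hlt x hx y h).ne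
    · exact hg hx hy h
    · exact absurd hxy (hlt y hy x h).ne'
  have himg : T.image r = Finset.range T.card := by
    apply Finset.eq_of_subset_of_card_le
    · intro k hk
      obtain ⟨x, hx, rfl⟩ := Finset.mem_image.1 hk
      rw [Finset.mem_range]
      apply Finset.card_lt_card
      exact Finset.filter_ssubset.2 ⟨x, hx, by simp⟩
    · rw [Finset.card_range, Finset.card_image_of_injOn hinj]
  have h2 : (T.filter fun x => r x < n).image r = Finset.range n := by
    ext k
    rw [Finset.mem_image, Finset.mem_range]
    constructor
    · rintro ⟨x, hx, rfl⟩
      exact (Finset.mem_filter.1 hx).2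
    · intro hk
      have : k ∈ T.image r := by rw [himg, Finset.mem_range]; omega
      obtain ⟨x, hx, rfl⟩ := Finset.mem_image.1 this
      exact ⟨x, Finset.mem_filter.2 ⟨hx, hk⟩, rfl⟩
  have h3 := congrArg Finset.card h2
  rwa [Finset.card_range, Finset.card_image_of_injOn] at h3
  intro x hx y hy
  rw [Finset.coe_filter] at hx hy
  exact hinj hx.1 hy.1

theorem boxesOn_subset_ladder (hℓ : 2 < ℓ) (μ : YoungDiagram) (k : ℕ) :
    boxesOn ℓ μ k ⊆ ladder ℓ k := fun _ hx => (mem_ladder hℓ).2 (mem_boxesOn.1 hx).2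

theorem mem_regularization (hℓ : 2 < ℓ) {x : ℕ × ℕ} :
    x ∈ regularization ℓ hℓ μ ↔
      ((ladder ℓ (ladderIndex ℓ x)).filter fun y => y.1 < x.1).card <
        (boxesOn ℓ μ (ladderIndex ℓ x)).card :=
  mem_regularizationCells hℓ

theorem ladder_injOn (hℓ : 2 < ℓ) (k : ℕ) : Set.InjOn Prod.fst (ladder ℓ k : Set (ℕ × ℕ)) := by
  intro x hx y hy hxy
  rw [Finset.mem_coe, mem_ladder hℓ] at hx hy
  refine Prod.ext hxy (Nat.eq_of_mul_eq_mul_left (show 0 < ℓ - 1 by omega) ?_)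
  omega

theorem sameLadders_regularization (hℓ : 2 < ℓ) (μ : YoungDiagram) :
    SameLadders ℓ (regularization ℓ hℓ μ) μ := by
  intro k
  rw [← card_filter_rank_lt (ladder ℓ k) Prod.fst (ladder_injOn hℓ k)
    (Finset.card_le_card (boxesOn_subset_ladder hℓ μ k))]
  congr 1
  ext x
  rw [mem_boxesOn, Finset.mem_filter, mem_ladder hℓ, and_comm]
  refine and_congr_right fun h => ?_
  rw [mem_regularization hℓ, show ladderIndex ℓ x = k from h]

theorem isTopJustified_regularization (hℓ : 2 < ℓ) (μ : YoungDiagram) :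
    IsTopJustified ℓ (regularization ℓ hℓ μ) := by
  intro a b h
  rw [mem_regularization hℓ] at h ⊢
  have h1 : ladderIndex ℓ (a, b + 1) = ladderIndex ℓ (a + (ℓ - 1), b) := by
    simp only [ladderIndex, mul_add]; omega
  rw [h1]
  refine lt_of_le_of_lt (Finset.card_le_card ?_) h
  intro y hy
  rw [Finset.mem_filter] at hy ⊢
  exact ⟨hy.1, lt_of_lt_of_le hy.2 (by simp)⟩

theorem regularization_eq (hℓ : 2 < ℓ) (hν : IsTopJustified ℓ ν) (h : SameLadders ℓ μ ν) :
    regularization ℓ hℓ μ = ν :=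
  (isTopJustified_regularization hℓ μ).eq_of_sameLadders hℓ hν fun k =>
    (sameLadders_regularization hℓ μ k).trans (h k)

theorem card_boxesOn_addBox {x : ℕ × ℕ} (h : IsAddable μ x) (k : ℕ) :
    (boxesOn ℓ (addBox μ x h) k).card =
      (boxesOn ℓ μ k).card + if ladderIndex ℓ x = k then 1 else 0 := by
  rw [boxesOn, addBox, Finset.filter_insert]
  split_ifs
  · rw [Finset.card_insert_of_notMem]
    · rfl
    · simp [h.1]
  · rfl

theorem card_boxesOn_removeBox {x : ℕ × ℕ} (h : IsRemovable μ x) (k : ℕ) :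
    (boxesOn ℓ (removeBox μ x h) k).card + (if ladderIndex ℓ x = k then 1 else 0) =
      (boxesOn ℓ μ k).card := by
  have := card_boxesOn_addBox (ℓ := ℓ) (isAddable_removeBox h) k
  rw [addBox_removeBox] at this
  exact this.symm

/-! ### Sums over ladders -/

/-- The function `F` moved down by `p` rows and right by `q` columns. -/
def shift (p q : ℕ) (F : ℕ × ℕ → ℤ) (x : ℕ × ℕ) : ℤ :=
  if p ≤ x.1 ∧ q ≤ x.2 then F (x.1 - p, x.2 - q) else 0

theorem sum_ladder_shift (hℓ : 2 < ℓ) (F : ℕ × ℕ → ℤ) (p q k : ℕ) :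
    ∑ x ∈ ladder ℓ (k + p + (ℓ - 1) * q), shift p q F x = ∑ x ∈ ladder ℓ k, F x := by
  simp only [shift]
  rw [← Finset.sum_filter]
  refine Finset.sum_nbij' (fun x => (x.1 - p, x.2 - q)) (fun x => (x.1 + p, x.2 + q))
    ?_ ?_ ?_ ?_ ?_
  · rintro ⟨a, b⟩ hx
    simp only [Finset.mem_filter, mem_ladder hℓ] at hx ⊢
    obtain ⟨h1, h2, h3⟩ := hx
    obtain ⟨s, rfl⟩ := Nat.exists_eq_add_of_le h2
    obtain ⟨t, rfl⟩ := Nat.exists_eq_add_of_le h3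
    rw [mul_add] at h1
    simp only [Nat.add_sub_cancel_left]
    omega
  · rintro ⟨a, b⟩ hx
    simp only [Finset.mem_filter, mem_ladder hℓ, mul_add] at hx ⊢
    omega
  · rintro ⟨a, b⟩ hx
    simp only [Finset.mem_filter] at hx
    simp only [Prod.mk.injEq]
    omega
  · rintro ⟨a, b⟩ -
    simp
  · rintro ⟨a, b⟩ -
    rfl

theorem sum_ladder_shift_of_lt (hℓ : 2 < ℓ) (F : ℕ × ℕ → ℤ) {p q k : ℕ}
    (hk : k < p + (ℓ - 1) * q) : ∑ x ∈ ladder ℓ k, shift p q F x = 0 := by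
  refine Finset.sum_eq_zero fun x hx => if_neg ?_
  rintro ⟨h1, h2⟩
  rw [mem_ladder hℓ] at hx
  have := Nat.mul_le_mul_left (ℓ - 1) h2
  omega

/-- A translation carries ladders into ladders, so ladder sums of a shifted function are determined
by the ladder sums of the function. Thus any combination of shifts of `boxInd` is controlled by the
ladder counts. -/
theorem sum_shift_congr (hℓ : 2 < ℓ) {F G : ℕ × ℕ → ℤ}
    (h : ∀ k, ∑ x ∈ ladder ℓ k, F x = ∑ x ∈ ladder ℓ k, G x) (p q k : ℕ) :
    ∑ x ∈ ladder ℓ k, shift p q F x = ∑ x ∈ ladder ℓ k, shift p q G x := by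
  rcases lt_or_ge k (p + (ℓ - 1) * q) with hk | hk
  · rw [sum_ladder_shift_of_lt hℓ _ hk, sum_ladder_shift_of_lt hℓ _ hk]
  · obtain ⟨k, rfl⟩ := Nat.exists_eq_add_of_le hk
    rw [show p + (ℓ - 1) * q + k = k + p + (ℓ - 1) * q by omega, sum_ladder_shift hℓ,
      sum_ladder_shift hℓ, h]

/-- The indicator function of a diagram. -/
def boxInd (μ : YoungDiagram) (x : ℕ × ℕ) : ℤ := if x ∈ μ then 1 else 0

open Classical in
/-- The indicator function of the addable positions. -/
noncomputable def addInd (μ : YoungDiagram) (x : ℕ × ℕ) : ℤ := if IsAddable μ x then 1 else 0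

open Classical in
/-- The indicator function of the removable boxes. -/
noncomputable def remInd (μ : YoungDiagram) (x : ℕ × ℕ) : ℤ := if IsRemovable μ x then 1 else 0

theorem sum_boxInd (hℓ : 2 < ℓ) (μ : YoungDiagram) (k : ℕ) :
    ∑ x ∈ ladder ℓ k, boxInd μ x = (boxesOn ℓ μ k).card := by
  simp only [boxInd]
  rw [Finset.sum_boole]
  congr 2
  ext x
  rw [Finset.mem_filter, mem_ladder hℓ, mem_boxesOn, and_comm]

theorem SameLadders.sum_boxInd (hℓ : 2 < ℓ) (h : SameLadders ℓ μ ν) (k : ℕ) :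
    ∑ x ∈ ladder ℓ k, boxInd μ x = ∑ x ∈ ladder ℓ k, boxInd ν x := by
  rw [LadderCrystal.sum_boxInd hℓ, LadderCrystal.sum_boxInd hℓ, h k]

theorem isAddable_iff_rowLen {a b : ℕ} :
    IsAddable μ (a, b) ↔ μ.rowLen a = b ∧ (a = 0 ∨ b < μ.rowLen (a - 1)) := by
  rw [isAddable_iff, lt_rowLen_iff]
  refine and_congr_right fun h => ?_
  have := (lt_rowLen_iff (μ := μ) (a := a) (b := b)).2
  omega

theorem isRemovable_iff_rowLen {a b : ℕ} :
    IsRemovable μ (a, b) ↔ μ.rowLen a = b + 1 ∧ μ.rowLen (a + 1) ≤ b := by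
  rw [isRemovable_iff]
  refine and_congr_right fun h => ?_
  have h1 := (lt_rowLen_iff (μ := μ) (a := a + 1) (b := b))
  have h2 := (lt_rowLen_iff (μ := μ) (a := a) (b := b)).1
  omega

/-- The mixed second difference of the indicator of a diagram detects the corners of its boundary:
`-1` at an addable position, `+1` diagonally after a removable box. The term at the origin corrects
for the edge of the quadrant. -/
theorem addInd_sub_remInd (μ : YoungDiagram) (x : ℕ × ℕ) :
    addInd μ x - shift 1 1 (remInd μ) x = (if x = (0, 0) then 1 else 0) +
      shift 1 0 (boxInd μ) x + shift 0 1 (boxInd μ) x - boxInd μ x - shift 1 1 (boxInd μ) x := by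
  obtain ⟨a, b⟩ := x
  simp only [addInd, remInd, boxInd, shift, isAddable_iff_rowLen, isRemovable_iff_rowLen,
    YoungDiagram.mem_iff_lt_rowLen, Prod.mk.injEq]
  rcases a with _ | a <;> rcases b with _ | b
  · simp; split_ifs <;> omega
  · simp; split_ifs <;> omega
  · have h := μ.rowLen_anti a (a + 1) (by omega)
    simp; split_ifs <;> omega
  · have h := μ.rowLen_anti a (a + 1) (by omega)
    simp; split_ifs <;> omega

theorem SameLadders.sum_addInd_sub (hℓ : 2 < ℓ) (h : SameLadders ℓ μ ν) (k : ℕ) :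
    ∑ x ∈ ladder ℓ k, addInd μ x - ∑ x ∈ ladder ℓ k, shift 1 1 (remInd μ) x =
      ∑ x ∈ ladder ℓ k, addInd ν x - ∑ x ∈ ladder ℓ k, shift 1 1 (remInd ν) x := by
  rw [← Finset.sum_sub_distrib, ← Finset.sum_sub_distrib]
  simp only [addInd_sub_remInd, Finset.sum_sub_distrib, Finset.sum_add_distrib]
  rw [sum_shift_congr hℓ (h.sum_boxInd hℓ), sum_shift_congr hℓ (h.sum_boxInd hℓ),
    sum_shift_congr hℓ (h.sum_boxInd hℓ), h.sum_boxInd hℓ]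

/-- The first ladder of each residue has number below `ℓ`, so no diagonally shifted removable box
reaches it. -/
theorem SameLadders.sum_addInd (hℓ : 2 < ℓ) (h : SameLadders ℓ μ ν) {k : ℕ} (hk : k < ℓ) :
    ∑ x ∈ ladder ℓ k, addInd μ x = ∑ x ∈ ladder ℓ k, addInd ν x := by
  have := h.sum_addInd_sub hℓ k
  rwa [sum_ladder_shift_of_lt hℓ _ (by omega), sum_ladder_shift_of_lt hℓ _ (by omega), sub_zero,
    sub_zero] at this

theorem SameLadders.sum_addInd_sub_remInd (hℓ : 2 < ℓ) (h : SameLadders ℓ μ ν) (k : ℕ) :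
    ∑ x ∈ ladder ℓ (k + ℓ), addInd μ x - ∑ x ∈ ladder ℓ k, remInd μ x =
      ∑ x ∈ ladder ℓ (k + ℓ), addInd ν x - ∑ x ∈ ladder ℓ k, remInd ν x := by
  have := h.sum_addInd_sub hℓ (k + 1 + (ℓ - 1) * 1)
  rwa [sum_ladder_shift hℓ, sum_ladder_shift hℓ, show k + 1 + (ℓ - 1) * 1 = k + ℓ by omega] at this

end Counting

/-! ### Comparison of the two signatures -/

section Labels

variable {ℓ : ℕ} {μ ν : YoungDiagram}

/-- The label of a letter of a signature: its ladder, and its sign. Ladders of the same residue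
are told apart by the quotient of their number by `ℓ`. -/
def label (ℓ : ℕ) (μ : YoungDiagram) (x : ℕ × ℕ) : ℕ × Bool := (ladderIndex ℓ x / ℓ, sgn μ x)

theorem labelLE_of_lt (hℓ : 2 < ℓ) {x y : ℕ × ℕ} (hr : residue ℓ x = residue ℓ y)
    (h : ladderIndex ℓ x < ladderIndex ℓ y) : LabelLE (label ℓ μ x) (label ℓ μ y) := by
  left
  have h1 : ladderIndex ℓ x + ℓ ≤ ladderIndex ℓ y := by
    by_contra h2
    have := ladderIndex_eq hℓ hr (by omega) (by omega)
    omega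
  have h2 := Nat.div_le_div_right (c := ℓ) h1
  rw [Nat.add_div_right _ (by omega)] at h2
  exact h2

theorem labelLE_of_eq {x y : ℕ × ℕ} (h : ladderIndex ℓ x = ladderIndex ℓ y)
    (hs : x ∈ μ → y ∈ μ) : LabelLE (label ℓ μ x) (label ℓ μ y) := by
  right
  simp only [label, h, true_and, sgn, decide_eq_true_eq]
  exact hs

/-- A removable box above an addable position on the same ladder gives a balanced hook, at the
crossing of its row with the column of that position. -/
theorem labelLE_of_ladderKey (hℓ : 2 < ℓ) (hμ : NoBalancedHook ℓ μ) {i : ZMod ℓ} {x y : ℕ × ℕ}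
    (hx : x ∈ signedBoxes ℓ i μ) (hy : y ∈ signedBoxes ℓ i μ)
    (h : ladderKey ℓ x < ladderKey ℓ y) : LabelLE (label ℓ μ x) (label ℓ μ y) := by
  rw [mem_signedBoxes] at hx hy
  rw [ladderKey_lt_iff hℓ] at h
  rcases h with h | ⟨h, h1⟩
  · exact labelLE_of_lt hℓ (hx.2.trans hy.2.symm) h
  · refine labelLE_of_eq h fun hxμ => ?_
    by_contra hyμ
    have hx' : IsRemovable μ x := hx.1.resolve_left fun h => h.1 hxμ
    have hy' : IsAddable μ y := hy.1.resolve_right fun h => hyμ h.1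
    obtain ⟨a, b⟩ := x
    obtain ⟨c, d⟩ := y
    obtain ⟨h2, h3⟩ := isRemovable_iff.1 hx'
    obtain ⟨h4, h5⟩ := isAddable_iff.1 hy'
    simp only [ladderIndex] at h h1
    refine hμ a d (YoungDiagram.mem_iff_lt_colLen.2 (by omega)) ?_
    rw [h2, h5, mul_add]
    omega

/-- For a top-justified diagram, the row reading of one residue already goes weakly from left to
right through the ladders: letters read earlier lie less than `ℓ` ladders to the right of later
ones, hence not to the right at all. -/
theorem labelLE_of_rowKey (hℓ : 2 < ℓ) (hμ : IsTopJustified ℓ μ) {i : ZMod ℓ} {x y : ℕ × ℕ}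
    (hx : x ∈ signedBoxes ℓ i μ) (hy : y ∈ signedBoxes ℓ i μ)
    (h : rowKey x < rowKey y) : LabelLE (label ℓ μ x) (label ℓ μ y) := by
  rw [mem_signedBoxes] at hx hy
  rw [rowKey_lt_iff] at h
  have hr := hx.2.trans hy.2.symm
  suffices hs : ladderIndex ℓ x < ladderIndex ℓ y + ℓ ∧
      (ladderIndex ℓ x = ladderIndex ℓ y → x ∈ μ → y ∈ μ) by
    rcases lt_or_ge (ladderIndex ℓ x) (ladderIndex ℓ y) with h1 | h1
    · exact labelLE_of_lt hℓ hr h1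
    · have h2 := ladderIndex_eq hℓ hr hs.1 (by omega)
      exact labelLE_of_eq h2 (hs.2 h2)
  obtain ⟨a, b⟩ := x
  obtain ⟨c, d⟩ := y
  obtain ⟨m, hm⟩ : ∃ m, ℓ - 1 = m := ⟨_, rfl⟩
  simp only [ladderIndex, hm] at h ⊢
  rcases h with h | ⟨rfl, h⟩
  · have hy2 : μ.rowLen c ≤ d + 1 := by
      rcases hy.1 with hy | hy
      · have := (isAddable_iff.1 hy).1; omega
      · exact (isRemovable_iff.1 hy).1.le
    -- Divide the height `e - c` by `m` and climb `t` ladder steps to row `c`. The box reached there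
    -- is not to the right of column `d`, which bounds the ladder of `(e, b)`.
    have key : ∀ e, (e, b) ∈ μ → c ≤ e → ∃ t s, s < m ∧ e = c + m * t + s ∧
        b + t < μ.rowLen c ∧ m * b + m * t ≤ m * d := by
      intro e he hce
      have h1 := Nat.div_add_mod (e - c) m
      have h2 : (e - c) % m < m := Nat.mod_lt _ (by omega)
      have h3 : (c, b + (e - c) / m) ∈ μ := by
        apply hμ.iterate
        rw [hm]
        exact μ.up_left_mem (by omega) le_rfl he
      rw [YoungDiagram.mem_iff_lt_rowLen] at h3
      refine ⟨_, _, h2, by omega, h3, ?_⟩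
      rw [← mul_add]
      exact Nat.mul_le_mul_left _ (by omega)
    rcases hx.1 with hx | hx
    · have hx2 := (isAddable_iff.1 hx).2
      -- An addable `x` is not a box, so the bound is applied to the box above it. The ladder bound
      -- grows by one to `s + 1 ≤ m`, still below `ℓ`.
      obtain ⟨t, s, hs, hat, -, hbt⟩ :=
        key (a - 1) (YoungDiagram.mem_iff_lt_colLen.2 (by omega)) (by omega)
      exact ⟨by omega, fun _ h => absurd h hx.1⟩
    · obtain ⟨t, s, hs, hat, hbt, hbt'⟩ := key a hx.1 h.le
      refine ⟨by omega, fun heq _ => ?_⟩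
      rw [YoungDiagram.mem_iff_lt_rowLen]
      by_contra hlt
      have := Nat.mul_le_mul_left m (show b + t + 1 ≤ d by omega)
      simp only [mul_add] at this
      omega
  · have := Nat.mul_lt_mul_of_pos_left h (show 0 < m by omega)
    exact ⟨by omega, fun _ => by omega⟩

/-- So `(-i).val` is the number of the first ladder of residue `i`. -/
theorem residue_eq_iff_mod (hℓ : 2 < ℓ) {i : ZMod ℓ} {x : ℕ × ℕ} :
    residue ℓ x = i ↔ ladderIndex ℓ x % ℓ = (-i).val := by
  have : NeZero ℓ := ⟨by omega⟩
  rw [residue_eq_ladderIndex hℓ, neg_eq_iff_eq_neg, ← ZMod.val_natCast,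
    (ZMod.val_injective ℓ).eq_iff]

theorem ladderIndex_eq_iff (hℓ : 2 < ℓ) {i : ZMod ℓ} {x : ℕ × ℕ} {j : ℕ} :
    ladderIndex ℓ x = (-i).val + ℓ * j ↔ residue ℓ x = i ∧ ladderIndex ℓ x / ℓ = j := by
  have : NeZero ℓ := ⟨by omega⟩
  rw [residue_eq_iff_mod hℓ]
  have h1 := Nat.mod_add_div (ladderIndex ℓ x) ℓ
  have h2 := ZMod.val_lt (-i)
  constructor
  · intro h
    rw [h, Nat.add_mul_mod_self_left, Nat.mod_eq_of_lt h2, Nat.add_mul_div_left _ _ (by omega),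
      Nat.div_eq_of_lt h2]
    simp
  · rintro ⟨h3, h4⟩
    rw [← h3, ← h4, h1]

theorem count_label {w : List (ℕ × ℕ)} (hw : w.Nodup) (z : ℕ × Bool) :
    (w.map (label ℓ μ)).count z = (w.toFinset.filter fun x => label ℓ μ x = z).card := by
  classical
  rw [List.count_eq_countP, List.countP_map, List.countP_eq_length_filter,
    ← List.toFinset_card_of_nodup (hw.filter _), List.toFinset_filter]
  congr 1
  ext x
  simp

theorem count_label_plus (hℓ : 2 < ℓ) {i : ZMod ℓ} {w : List (ℕ × ℕ)} (hw : w.Nodup)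
    (h : ∀ x, x ∈ w ↔ x ∈ signedBoxes ℓ i μ) (j : ℕ) :
    ((w.map (label ℓ μ)).count (j, false) : ℤ) =
      ∑ x ∈ ladder ℓ ((-i).val + ℓ * j), addInd μ x := by
  classical
  simp only [addInd]
  rw [count_label hw, Finset.sum_boole]
  congr 2
  ext x
  rw [Finset.mem_filter, Finset.mem_filter, List.mem_toFinset, h, mem_signedBoxes, mem_ladder hℓ]
  change _ ↔ ladderIndex ℓ x = _ ∧ _
  rw [ladderIndex_eq_iff hℓ]
  simp only [label, sgn, Prod.mk.injEq, decide_eq_false_iff_not]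
  have h1 : IsAddable μ x → x ∉ μ := fun h => h.1
  have h2 : IsRemovable μ x → x ∈ μ := fun h => h.1
  tauto

theorem count_label_minus (hℓ : 2 < ℓ) {i : ZMod ℓ} {w : List (ℕ × ℕ)} (hw : w.Nodup)
    (h : ∀ x, x ∈ w ↔ x ∈ signedBoxes ℓ i μ) (j : ℕ) :
    ((w.map (label ℓ μ)).count (j, true) : ℤ) =
      ∑ x ∈ ladder ℓ ((-i).val + ℓ * j), remInd μ x := by
  classical
  simp only [remInd]
  rw [count_label hw, Finset.sum_boole]
  congr 2
  ext x
  rw [Finset.mem_filter, Finset.mem_filter, List.mem_toFinset, h, mem_signedBoxes, mem_ladder hℓ]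
  change _ ↔ ladderIndex ℓ x = _ ∧ _
  rw [ladderIndex_eq_iff hℓ]
  simp only [label, sgn, Prod.mk.injEq, decide_eq_true_eq]
  have h1 : IsAddable μ x → x ∉ μ := fun h => h.1
  have h2 : IsRemovable μ x → x ∈ μ := fun h => h.1
  tauto

/-- The reduced ladder signature and the reduced signature have the same labels. -/
theorem map_label_red (hℓ : 2 < ℓ) (hν : NoBalancedHook ℓ ν) (hμ : IsTopJustified ℓ μ)
    (h : SameLadders ℓ ν μ) (i : ZMod ℓ) :
    (red (sgn ν) (ladderSignature ℓ i ν)).map (label ℓ ν) =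
      (red (sgn μ) (signature ℓ i μ)).map (label ℓ μ) := by
  have : NeZero ℓ := ⟨by omega⟩
  have e1 : sgn ν = fun x => Prod.snd (label ℓ ν x) := rfl
  have e2 : sgn μ = fun x => Prod.snd (label ℓ μ x) := rfl
  rw [e1, e2, ← red_map, ← red_map]
  have n1 : (ladderSignature ℓ i ν).Nodup := nodup_listBy
  have n2 : (signature ℓ i μ).Nodup := nodup_listBy
  have m1 : ∀ x, x ∈ ladderSignature ℓ i ν ↔ x ∈ signedBoxes ℓ i ν := fun x => mem_listBy
  have m2 : ∀ x, x ∈ signature ℓ i μ ↔ x ∈ signedBoxes ℓ i μ := fun x => mem_listBy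
  apply red_eq_of_count
  · rw [List.pairwise_map]
    exact pairwise_listBy.imp_of_mem fun hx hy =>
      labelLE_of_ladderKey hℓ hν (mem_listBy.1 hx) (mem_listBy.1 hy)
  · rw [List.pairwise_map]
    exact pairwise_listBy.imp_of_mem fun hx hy =>
      labelLE_of_rowKey hℓ hμ (mem_listBy.1 hx) (mem_listBy.1 hy)
  · have h1 := count_label_plus hℓ n1 m1 0
    rw [h.sum_addInd hℓ (by simpa using ZMod.val_lt (-i)), ← count_label_plus hℓ n2 m2] at h1
    exact_mod_cast h1
  · intro j
    have h1 := h.sum_addInd_sub_remInd hℓ ((-i).val + ℓ * j)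
    rw [show (-i).val + ℓ * j + ℓ = (-i).val + ℓ * (j + 1) by ring, ← count_label_plus hℓ n1 m1,
      ← count_label_plus hℓ n2 m2, ← count_label_minus hℓ n1 m1, ← count_label_minus hℓ n2 m2] at h1
    omega

end Labels

/-! ### Regularization commutes with the crystal operators -/

section Intertwining

variable {ℓ : ℕ} {μ ν : YoungDiagram}

theorem filter_map_label (p : Bool → Bool) (w : List (ℕ × ℕ)) :
    (w.map (label ℓ μ)).filter (fun z => p z.2) =
      (w.filter fun x => p (sgn μ x)).map (label ℓ μ) := by
  rw [List.filter_map]; rfl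

theorem map_label_conormal (hℓ : 2 < ℓ) (hν : NoBalancedHook ℓ ν) (hμ : IsTopJustified ℓ μ)
    (h : SameLadders ℓ ν μ) (i : ZMod ℓ) :
    (conormalBoxes ν (ladderSignature ℓ i ν)).map (label ℓ ν) =
      (conormalBoxes μ (signature ℓ i μ)).map (label ℓ μ) := by
  rw [conormalBoxes_eq, conormalBoxes_eq, ← filter_map_label (fun s => !s),
    ← filter_map_label (fun s => !s), map_label_red hℓ hν hμ h]

theorem map_label_normal (hℓ : 2 < ℓ) (hν : NoBalancedHook ℓ ν) (hμ : IsTopJustified ℓ μ)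
    (h : SameLadders ℓ ν μ) (i : ZMod ℓ) :
    (normalBoxes ν (ladderSignature ℓ i ν)).map (label ℓ ν) =
      (normalBoxes μ (signature ℓ i μ)).map (label ℓ μ) := by
  rw [normalBoxes_eq, normalBoxes_eq]
  have h1 := congrArg (List.filter fun z => z.2) (map_label_red hℓ hν hμ h i)
  exact (filter_map_label id _).symm.trans (h1.trans (filter_map_label id _))

theorem ladderIndex_eq_of_label (hℓ : 2 < ℓ) {x y : ℕ × ℕ} (hr : residue ℓ x = residue ℓ y)
    (h : label ℓ μ x = label ℓ ν y) : ladderIndex ℓ x = ladderIndex ℓ y := by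
  have h1 : ladderIndex ℓ x / ℓ = ladderIndex ℓ y / ℓ := congrArg Prod.fst h
  have h2 : ladderIndex ℓ x % ℓ = ladderIndex ℓ y % ℓ := ladderIndex_modEq hℓ hr
  rw [← Nat.mod_add_div (ladderIndex ℓ x) ℓ, h1, h2, Nat.mod_add_div]

theorem mem_signedBoxes_of_mem_conormal {i : ZMod ℓ} {α : Type} [LinearOrder α]
    {key : ℕ × ℕ → α} {hkey : Function.Injective key} {x : ℕ × ℕ}
    (h : x ∈ conormalBoxes μ (listBy key hkey (signedBoxes ℓ i μ))) :
    IsAddable μ x ∧ residue ℓ x = i := by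
  rw [conormalBoxes_eq, List.mem_filter] at h
  have h1 := mem_listBy.1 ((red_sublist _).subset h.1)
  exact ⟨isAddable_of_mem_signedBoxes h1 (by simpa using h.2), (mem_signedBoxes.1 h1).2⟩

theorem mem_signedBoxes_of_mem_normal {i : ZMod ℓ} {α : Type} [LinearOrder α]
    {key : ℕ × ℕ → α} {hkey : Function.Injective key} {x : ℕ × ℕ}
    (h : x ∈ normalBoxes μ (listBy key hkey (signedBoxes ℓ i μ))) :
    IsRemovable μ x ∧ residue ℓ x = i := by
  rw [normalBoxes_eq, List.mem_filter] at h
  have h1 := mem_listBy.1 ((red_sublist _).subset h.1)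
  exact ⟨isRemovable_of_mem_signedBoxes h1 (by simpa using h.2), (mem_signedBoxes.1 h1).2⟩

theorem exists_pivot_of_fOfWord {i : ZMod ℓ} {α : Type} [LinearOrder α]
    {key : ℕ × ℕ → α} {hkey : Function.Injective key}
    (h : fOfWord μ (listBy key hkey (signedBoxes ℓ i μ)) = some ν) :
    ∃ x, ∃ hx : IsAddable μ x,
      IsPivot (sgn μ) (listBy key hkey (signedBoxes ℓ (residue ℓ x) μ)) x ∧
        addBox μ x hx = ν := by
  obtain ⟨x, hx, hp, h⟩ := (fOfWord_eq_some_iff nodup_listBy).1 h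
  have hxw : x ∈ listBy key hkey (signedBoxes ℓ i μ) := by
    obtain ⟨u, v, hw, -⟩ := hp; rw [hw]; simp
  have hr := (mem_signedBoxes.1 (mem_listBy.1 hxw)).2
  exact ⟨x, hx, by rwa [hr], h⟩

theorem exists_pivot_of_eOfWord {i : ZMod ℓ} {α : Type} [LinearOrder α]
    {key : ℕ × ℕ → α} {hkey : Function.Injective key}
    (h : eOfWord μ (listBy key hkey (signedBoxes ℓ i μ)) = some ν) :
    ∃ x, ∃ hx : IsRemovable μ x,
      IsPivot (sgn μ) (listBy key hkey (signedBoxes ℓ (residue ℓ x) μ)) x ∧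
        removeBox μ x hx = ν := by
  obtain ⟨x, hx, hp, h⟩ := (eOfWord_eq_some_iff nodup_listBy).1 h
  have hxw : x ∈ listBy key hkey (signedBoxes ℓ i μ) := by
    obtain ⟨u, v, hw, -⟩ := hp; rw [hw]; simp
  have hr := (mem_signedBoxes.1 (mem_listBy.1 hxw)).2
  exact ⟨x, hx, by rwa [hr], h⟩

theorem NoBalancedHook.of_fOfWord (hℓ : 2 < ℓ) {i : ZMod ℓ} (hμ : NoBalancedHook ℓ μ)
    (h : fOfWord μ (ladderSignature ℓ i μ) = some ν) : NoBalancedHook ℓ ν := by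
  obtain ⟨x, hx, hp, rfl⟩ := exists_pivot_of_fOfWord h
  exact hμ.addBox hℓ hx hp

theorem NoBalancedHook.of_eOfWord (hℓ : 2 < ℓ) {i : ZMod ℓ} (hμ : NoBalancedHook ℓ μ)
    (h : eOfWord μ (ladderSignature ℓ i μ) = some ν) : NoBalancedHook ℓ ν := by
  obtain ⟨x, hx, hp, rfl⟩ := exists_pivot_of_eOfWord h
  exact hμ.removeBox hℓ hx hp

theorem IsTopJustified.of_fOfWord (hℓ : 2 < ℓ) {i : ZMod ℓ} (hμ : IsTopJustified ℓ μ)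
    (h : fOfWord μ (signature ℓ i μ) = some ν) : IsTopJustified ℓ ν := by
  obtain ⟨x, hx, hp, rfl⟩ := exists_pivot_of_fOfWord h
  exact hμ.addBox hℓ hx hp

theorem IsTopJustified.of_eOfWord (hℓ : 2 < ℓ) {i : ZMod ℓ} (hμ : IsTopJustified ℓ μ)
    (h : eOfWord μ (signature ℓ i μ) = some ν) : IsTopJustified ℓ ν := by
  obtain ⟨x, hx, hp, rfl⟩ := exists_pivot_of_eOfWord h
  exact hμ.removeBox hℓ hx hp

/-- The last conormal boxes on both sides have the same label and residue, hence the same ladder. So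
the two results have equal ladder counts, and the one on the regular side is still top-justified; it
must be the regularization of the other. -/
theorem regularization_fOfWord (hℓ : 2 < ℓ) (hν : NoBalancedHook ℓ ν) (i : ZMod ℓ) :
    (fOfWord ν (ladderSignature ℓ i ν)).map (regularization ℓ hℓ) =
      fOfWord (regularization ℓ hℓ ν) (signature ℓ i (regularization ℓ hℓ ν)) := by
  have hμ := isTopJustified_regularization hℓ ν
  have hs := sameLadders_regularization hℓ ν
  set μ := regularization ℓ hℓ ν with hμν
  have hl := congrArg List.getLast? (map_label_conormal hℓ hν hμ (fun k => (hs k).symm) i)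
  rw [List.getLast?_map, List.getLast?_map] at hl
  rcases h1 : (conormalBoxes ν (ladderSignature ℓ i ν)).getLast? with _ | x <;>
  rcases h2 : (conormalBoxes μ (signature ℓ i μ)).getLast? with _ | y
  · simp [fOfWord, h1, h2]
  · rw [h1, h2] at hl; simp at hl
  · rw [h1, h2] at hl; simp at hl
  · rw [h1, h2, Option.map_some, Option.map_some, Option.some.injEq] at hl
    obtain ⟨hx, hxr⟩ := mem_signedBoxes_of_mem_conormal (List.mem_of_getLast? h1)
    obtain ⟨hy, hyr⟩ := mem_signedBoxes_of_mem_conormal (List.mem_of_getLast? h2)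
    have e1 : fOfWord ν (ladderSignature ℓ i ν) = some (addBox ν x hx) := by
      simp [fOfWord, h1, hx]
    have e2 : fOfWord μ (signature ℓ i μ) = some (addBox μ y hy) := by
      simp [fOfWord, h2, hy]
    rw [e1, e2, Option.map_some]
    congr 1
    apply regularization_eq hℓ (hμ.of_fOfWord hℓ e2)
    intro k
    rw [card_boxesOn_addBox, card_boxesOn_addBox,
      ladderIndex_eq_of_label hℓ (hxr.trans hyr.symm) hl, hs k]

theorem regularization_eOfWord (hℓ : 2 < ℓ) (hν : NoBalancedHook ℓ ν) (i : ZMod ℓ) :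
    (eOfWord ν (ladderSignature ℓ i ν)).map (regularization ℓ hℓ) =
      eOfWord (regularization ℓ hℓ ν) (signature ℓ i (regularization ℓ hℓ ν)) := by
  have hμ := isTopJustified_regularization hℓ ν
  have hs := sameLadders_regularization hℓ ν
  set μ := regularization ℓ hℓ ν with hμν
  have hl := congrArg List.head? (map_label_normal hℓ hν hμ (fun k => (hs k).symm) i)
  rw [List.head?_map, List.head?_map] at hl
  rcases h1 : (normalBoxes ν (ladderSignature ℓ i ν)).head? with _ | x <;>
  rcases h2 : (normalBoxes μ (signature ℓ i μ)).head? with _ | y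
  · simp [eOfWord, h1, h2]
  · rw [h1, h2] at hl; simp at hl
  · rw [h1, h2] at hl; simp at hl
  · rw [h1, h2, Option.map_some, Option.map_some, Option.some.injEq] at hl
    obtain ⟨hx, hxr⟩ := mem_signedBoxes_of_mem_normal (List.mem_of_head? h1)
    obtain ⟨hy, hyr⟩ := mem_signedBoxes_of_mem_normal (List.mem_of_head? h2)
    have e1 : eOfWord ν (ladderSignature ℓ i ν) = some (removeBox ν x hx) := by
      simp [eOfWord, h1, hx]
    have e2 : eOfWord μ (signature ℓ i μ) = some (removeBox μ y hy) := by
      simp [eOfWord, h2, hy]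
    rw [e1, e2, Option.map_some]
    congr 1
    apply regularization_eq hℓ (hμ.of_eOfWord hℓ e2)
    intro k
    have k1 := card_boxesOn_removeBox (ℓ := ℓ) hx k
    have k2 := card_boxesOn_removeBox (ℓ := ℓ) hy k
    rw [ladderIndex_eq_of_label hℓ (hxr.trans hyr.symm) hl, ← hs k, ← k2] at k1
    exact Nat.add_right_cancel k1

end Intertwining

/-! ### Deregularization inverts regularization -/

section Deregularization

variable {ℓ : ℕ} {μ ν : YoungDiagram}

/-- The positions on the `k`-th ladder in the first row or directly below a box. -/
def supportedOn (ℓ : ℕ) (μ : YoungDiagram) (k : ℕ) : Finset (ℕ × ℕ) :=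
  (ladder ℓ k).filter fun x => x.1 = 0 ∨ (x.1 - 1, x.2) ∈ μ

theorem mem_supportedOn (hℓ : 2 < ℓ) {k : ℕ} {x : ℕ × ℕ} :
    x ∈ supportedOn ℓ μ k ↔ ladderIndex ℓ x = k ∧ (x.1 = 0 ∨ (x.1 - 1, x.2) ∈ μ) := by
  rw [supportedOn, Finset.mem_filter, mem_ladder hℓ, ladderIndex]

theorem boxesOn_subset_supportedOn (hℓ : 2 < ℓ) (k : ℕ) :
    boxesOn ℓ μ k ⊆ supportedOn ℓ μ k := by
  intro x hx
  rw [mem_boxesOn] at hx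
  rw [mem_supportedOn hℓ]
  exact ⟨hx.2, Or.inr (μ.up_left_mem (Nat.sub_le _ _) le_rfl hx.1)⟩

/-- The positions directly below a box are a shift of the diagram, so their number on a ladder is
determined by the ladder counts. -/
theorem SameLadders.card_supportedOn (hℓ : 2 < ℓ) (h : SameLadders ℓ μ ν) (k : ℕ) :
    (supportedOn ℓ μ k).card = (supportedOn ℓ ν k).card := by
  have key : ∀ ξ : YoungDiagram, ((supportedOn ℓ ξ k).card : ℤ) =
      ∑ x ∈ ladder ℓ k, (if x.1 = 0 then 1 else 0) + ∑ x ∈ ladder ℓ k, shift 1 0 (boxInd ξ) x := by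
    intro ξ
    rw [← Finset.sum_add_distrib, supportedOn, ← Finset.sum_boole]
    refine Finset.sum_congr rfl fun x _ => ?_
    obtain ⟨a, b⟩ := x
    rcases a with _ | a <;> simp [shift, boxInd]
  have h1 := key μ
  rw [sum_shift_congr hℓ (h.sum_boxInd hℓ), ← key ν] at h1
  exact_mod_cast h1

theorem SameLadders.supportedOn_subset (hℓ : 2 < ℓ) (h : SameLadders ℓ μ ν) {k : ℕ}
    (hμ : supportedOn ℓ μ k ⊆ boxesOn ℓ μ k) : supportedOn ℓ ν k ⊆ boxesOn ℓ ν k := by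
  have h1 := Finset.card_le_card hμ
  rw [h.card_supportedOn hℓ, h k] at h1
  exact (Finset.eq_of_subset_of_card_le (boxesOn_subset_supportedOn hℓ k) h1).ge

theorem lockCondition_of_subset (hℓ : 2 < ℓ) {x : ℕ × ℕ}
    (h : supportedOn ℓ μ (ladderIndex ℓ x) ⊆ boxesOn ℓ μ (ladderIndex ℓ x)) :
    LockCondition ℓ μ x := by
  intro c d hcd _ hcμ hμ
  exact hcμ (mem_boxesOn.1 (h ((mem_supportedOn hℓ).2 ⟨hcd, Or.inr hμ⟩))).1

/-- Top-justification fills the ladder from `x` upwards and the lock condition handles the part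
below. Thus the condition becomes a property of the whole ladder, and
`SameLadders.supportedOn_subset` transfers it to other diagrams. -/
theorem LockCondition.subset (hℓ : 2 < ℓ) (hμ : IsTopJustified ℓ μ) {x : ℕ × ℕ} (hx : x ∈ μ)
    (h : LockCondition ℓ μ x) :
    supportedOn ℓ μ (ladderIndex ℓ x) ⊆ boxesOn ℓ μ (ladderIndex ℓ x) := by
  rintro ⟨a, b⟩ hy
  rw [mem_supportedOn hℓ] at hy
  obtain ⟨h1, h2⟩ := hy
  refine mem_boxesOn.2 ⟨?_, h1⟩
  rcases lt_or_ge x.1 a with hlt | hge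
  · obtain ⟨c, rfl⟩ : ∃ c, a = c + 1 := ⟨a - 1, by omega⟩
    by_contra hcon
    rcases h2 with h2 | h2
    · simp at h2
    · exact h c b h1 hlt hcon h2
  · exact hμ.mem_of_le hℓ h1 hge hx

theorem IsLocked.mem {x : ℕ × ℕ} (h : IsLocked ℓ μ x) : x ∈ μ := by
  induction h with
  | firstRow hx _ => exact hx
  | belowLocked hx _ _ _ => exact hx
  | leftOfLocked hb _ ih => exact μ.up_left_mem le_rfl hb.le ih

/-- The locked boxes belong to all diagrams with the same number of boxes on each ladder. -/
theorem IsLocked.mem_of_sameLadders (hℓ : 2 < ℓ) (hμ : IsTopJustified ℓ μ)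
    (h : SameLadders ℓ μ ν) {x : ℕ × ℕ} (hx : IsLocked ℓ μ x) : x ∈ ν := by
  induction hx with
  | firstRow hx hc =>
    have h1 := h.supportedOn_subset hℓ (hc.subset hℓ hμ hx)
    exact (mem_boxesOn.1 (h1 ((mem_supportedOn hℓ).2 ⟨rfl, Or.inl rfl⟩))).1
  | belowLocked hx _ hc ih =>
    have h1 := h.supportedOn_subset hℓ (hc.subset hℓ hμ hx)
    exact (mem_boxesOn.1 (h1 ((mem_supportedOn hℓ).2 ⟨rfl, Or.inr ih⟩))).1
  | leftOfLocked hb _ ih => exact ν.up_left_mem le_rfl hb.le ih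

theorem exists_crossing (f : ℕ → ℕ) {T i j : ℕ} (hi : f i < T) (hj : T ≤ f j) (hij : i ≤ j) :
    ∃ n, i ≤ n ∧ n < j ∧ f n < T ∧ T ≤ f (n + 1) := by
  induction j, hij using Nat.le_induction with
  | base => omega
  | succ j hij ih =>
    rcases lt_or_ge (f j) T with h | h
    · exact ⟨j, hij, by omega, h, hj⟩
    · obtain ⟨n, h1, h2, h3⟩ := ih h
      exact ⟨n, h1, by omega, h3⟩

/-- If a row ends on a later ladder than some column crossing it, then no column ends on the
ladder before the last box of the row. -/
theorem NoBalancedHook.supportedOn_subset (hℓ : 2 < ℓ) (hν : NoBalancedHook ℓ ν) {a d r : ℕ}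
    (hr : ν.rowLen a = r + 1) (hd : d ≤ r)
    (h : ν.colLen d + (ℓ - 1) * d < a + (ℓ - 1) * r) :
    supportedOn ℓ ν (a + (ℓ - 1) * r) ⊆ boxesOn ℓ ν (a + (ℓ - 1) * r) := by
  rintro ⟨c, e⟩ hy
  rw [mem_supportedOn hℓ] at hy
  refine mem_boxesOn.2 ⟨?_, hy.1⟩
  by_contra hyν
  obtain ⟨m, hm⟩ : ∃ m, ℓ - 1 = m := ⟨_, rfl⟩
  have hbad := hν
  simp only [NoBalancedHook, ladderIndex, hm] at hy h hbad
  obtain ⟨hk, hc⟩ := hy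
  have hce : ν.colLen e = c := by
    rw [YoungDiagram.mem_iff_lt_colLen] at hyν hc
    omega
  have hcol : ∀ f, f ≤ r → a < ν.colLen f := fun f hf => lt_rowLen_iff.1 (by omega)
  have hrow : ∀ f, f ≤ r → (a, f) ∈ ν := fun f hf => YoungDiagram.mem_iff_lt_rowLen.2 (by omega)
  rcases le_or_gt e r with her | her
  · refine hbad a e (hrow e her) ?_
    rw [hr, hce, mul_add]
    omega
  -- The ladders of the column bottoms pass that of the row end between columns `f` and `f + 1`.
  -- Equality at `f + 1` is excluded, and one column adds at most `m`, so the forbidden value for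
  -- column `f`, its bottom ladder plus `m`, exceeds `a + m * r`.
  · obtain ⟨f, hdf, hfr, hf1, hf2⟩ := exists_crossing (fun f => ν.colLen f + m * f) h
      (show a + m * r ≤ ν.colLen r + m * r by have := hcol r le_rfl; omega) hd
    have hf3 : ν.colLen (f + 1) + m * (f + 1) ≠ a + m * r := by
      intro h3
      refine hbad a (f + 1) (hrow _ (by omega)) ?_
      rw [hr, h3, mul_add]
      omega
    have hf4 := ν.colLen_anti f (f + 1) (by omega)
    rw [mul_add] at hf2 hf3
    have hca : c ≤ a := by
      have := Nat.mul_le_mul_left m her.le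
      omega
    have hrc : ν.rowLen c ≤ e := by
      rw [YoungDiagram.mem_iff_lt_rowLen] at hyν
      omega
    have hrc' := Nat.mul_le_mul_left m hrc
    -- Going down from row `c` to row `a`, the quantity `g + m * rowLen g` starts below the
    -- forbidden value for column `f` and ends above it. It rises by at most `1` per row, so it
    -- takes that value exactly, which is a balanced hook.
    obtain ⟨g, hcg, hga, hg1, hg2⟩ := exists_crossing (fun g => g + m * ν.rowLen g)
      (T := ν.colLen f + m * f + m) (i := c) (j := a) (by omega)
      (by simp only [hr, mul_add]; omega) hca
    have hg3 := Nat.mul_le_mul_left m (ν.rowLen_anti g (g + 1) (by omega))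
    have hg4 := hcol f hfr.le
    exact hbad (g + 1) f (YoungDiagram.mem_iff_lt_colLen.2 (by omega)) (by omega)

/-- The hypothesis on column `d` passes to the row above, so by induction the end of that row is
locked, hence also the box over `(a, r)` by type II. On the ladder of `(a, r)` every supported
position is occupied, which gives both membership in `μ` and the lock condition. -/
theorem NoBalancedHook.isLocked_rowEnd (hℓ : 2 < ℓ) (hν : NoBalancedHook ℓ ν)
    (hs : SameLadders ℓ ν μ) {d : ℕ} (a : ℕ) :
    ∀ r, ν.rowLen a = r + 1 → d ≤ r → ν.colLen d + (ℓ - 1) * d < a + (ℓ - 1) * r →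
      IsLocked ℓ μ (a, r) := by
  induction a with
  | zero =>
    intro r hr hd h
    have h1 := hs.supportedOn_subset hℓ (hν.supportedOn_subset hℓ hr hd h)
    exact IsLocked.firstRow (mem_boxesOn.1 (h1 ((mem_supportedOn hℓ).2 ⟨rfl, Or.inl rfl⟩))).1
      (lockCondition_of_subset hℓ h1)
  | succ a ih =>
    intro r hr hd h
    have h1 := hs.supportedOn_subset hℓ (hν.supportedOn_subset hℓ hr hd h)
    have h2 := ν.rowLen_anti a (a + 1) (by omega)
    obtain ⟨t, ht⟩ : ∃ t, ν.rowLen a = r + t + 1 := ⟨ν.rowLen a - r - 1, by omega⟩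
    -- One row up, the strict inequality could only weaken to an equality, which would be a balanced
    -- hook.
    have h3 := hν a d (YoungDiagram.mem_iff_lt_rowLen.2 (by omega))
    have h4 : (ℓ - 1) * (r + t) = (ℓ - 1) * r + (ℓ - 1) * t := mul_add _ _ _
    rw [ht, mul_add _ (r + t)] at h3
    have h5 := ih (r + t) ht (by omega) (by omega)
    have h6 : IsLocked ℓ μ (a, r) := by
      rcases Nat.eq_zero_or_pos t with rfl | ht0
      · exact h5
      · exact IsLocked.leftOfLocked (by omega) h5
    have h7 : (a + 1, r) ∈ supportedOn ℓ μ (a + 1 + (ℓ - 1) * r) :=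
      (mem_supportedOn hℓ).2 ⟨rfl, Or.inr h6.mem⟩
    exact IsLocked.belowLocked (mem_boxesOn.1 (h1 h7)).1 h6
      (lockCondition_of_subset hℓ h1)

/-- A box above an unoccupied position of its ladder is locked in the regularization. -/
theorem NoBalancedHook.isLocked_of_above (hℓ : 2 < ℓ) (hν : NoBalancedHook ℓ ν)
    (hs : SameLadders ℓ ν μ) {x y : ℕ × ℕ} (hx : x ∈ ν) (hy : y ∉ ν)
    (hxy : ladderIndex ℓ x = ladderIndex ℓ y) (hlt : x.1 < y.1) : IsLocked ℓ μ x := by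
  obtain ⟨a, b⟩ := x
  obtain ⟨c, d⟩ := y
  simp only [ladderIndex] at hxy hlt
  rw [YoungDiagram.mem_iff_lt_rowLen] at hx
  rw [YoungDiagram.mem_iff_lt_colLen] at hy
  have hdb : d < b := by
    by_contra hge
    have := Nat.mul_le_mul_left (ℓ - 1) (show b ≤ d by omega)
    omega
  obtain ⟨t, ht⟩ : ∃ t, ν.rowLen a = b + t + 1 := ⟨ν.rowLen a - b - 1, by omega⟩
  -- The bottom of column `d` is at or above the gap `y`, so its ladder is at most that of the end
  -- of row `a`; this excludes equality.
  have h3 := hν a d (YoungDiagram.mem_iff_lt_rowLen.2 (by omega))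
  have h4 : (ℓ - 1) * (b + t) = (ℓ - 1) * b + (ℓ - 1) * t := mul_add _ _ _
  rw [ht, mul_add _ (b + t)] at h3
  have h5 := hν.isLocked_rowEnd hℓ hs a (b + t) ht (by omega : d ≤ b + t) (by omega)
  rcases Nat.eq_zero_or_pos t with rfl | ht0
  · exact h5
  · exact IsLocked.leftOfLocked (by omega) h5

open Classical in
theorem mem_deregularizationCells (hℓ : 2 < ℓ) {x : ℕ × ℕ} :
    x ∈ deregularizationCells ℓ μ ↔ IsLocked ℓ μ x ∨
      ((ladder ℓ (ladderIndex ℓ x)).filter fun y => x.1 < y.1 ∧ ¬ IsLocked ℓ μ y).card <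
        ((boxesOn ℓ μ (ladderIndex ℓ x)).filter fun y => ¬ IsLocked ℓ μ y).card := by
  simp only [deregularizationCells, Finset.mem_biUnion, Finset.mem_image, Finset.mem_filter]
  constructor
  · rintro ⟨k, -, hx, h⟩
    have hk : ladderIndex ℓ x = k := (mem_ladder hℓ).1 hx
    rwa [hk]
  · intro h
    refine ⟨ladderIndex ℓ x, ?_, (mem_ladder hℓ).2 rfl, h⟩
    rcases h with h | h
    · exact ⟨x, (YoungDiagram.mem_cells _).2 h.mem, rfl⟩
    · obtain ⟨y, hy⟩ := Finset.card_pos.1 (lt_of_le_of_lt (Nat.zero_le _) h)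
      rw [Finset.mem_filter, mem_boxesOn] at hy
      exact ⟨y, (YoungDiagram.mem_cells _).2 hy.1.1, hy.1.2⟩

/-- The locked boxes of `μ` lie in `ν`, so both diagrams have equally many unlocked boxes on each
ladder. In `ν` no unlocked box is above a gap, so counting the free positions below `x` decides
whether `x` is in `ν`. -/
theorem deregularizationCells_eq (hℓ : 2 < ℓ) (hν : NoBalancedHook ℓ ν)
    (hμ : IsTopJustified ℓ μ) (hs : SameLadders ℓ ν μ) :
    deregularizationCells ℓ μ = ν.cells := by
  classical
  have hlock : ∀ {y}, IsLocked ℓ μ y → y ∈ ν := fun h =>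
    h.mem_of_sameLadders hℓ hμ fun k => (hs k).symm
  have hcard : ∀ k, ((boxesOn ℓ μ k).filter fun y => ¬ IsLocked ℓ μ y).card =
      ((boxesOn ℓ ν k).filter fun y => ¬ IsLocked ℓ μ y).card := by
    intro k
    have h1 := Finset.card_filter_add_card_filter_not (s := boxesOn ℓ μ k) (IsLocked ℓ μ)
    have h2 := Finset.card_filter_add_card_filter_not (s := boxesOn ℓ ν k) (IsLocked ℓ μ)
    have h3 : (boxesOn ℓ μ k).filter (IsLocked ℓ μ) = (boxesOn ℓ ν k).filter (IsLocked ℓ μ) := by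
      ext y
      simp only [Finset.mem_filter, mem_boxesOn]
      refine and_congr_left fun h => and_congr_left fun _ => ?_
      exact iff_of_true h.mem (hlock h)
    rw [h3] at h1
    have := hs k
    omega
  ext x
  rw [mem_deregularizationCells hℓ, YoungDiagram.mem_cells, hcard]
  by_cases hx : IsLocked ℓ μ x
  · exact iff_of_true (Or.inl hx) (hlock hx)
  rw [or_iff_right hx]
  constructor
  · intro h
    by_contra hxν
    refine absurd h (not_lt.2 (Finset.card_le_card fun u hu => ?_))
    rw [Finset.mem_filter, mem_boxesOn] at hu
    obtain ⟨⟨huν, huk⟩, hul⟩ := hu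
    refine Finset.mem_filter.2 ⟨(mem_ladder hℓ).2 huk, ?_, hul⟩
    rcases lt_trichotomy x.1 u.1 with h1 | h1 | h1
    · exact h1
    · have : x = u := ladder_injOn hℓ (ladderIndex ℓ x) ((mem_ladder hℓ).2 rfl)
        ((mem_ladder hℓ).2 huk) h1
      exact absurd (this ▸ huν) hxν
    · exact absurd (hν.isLocked_of_above hℓ hs huν hxν huk h1) hul
  · intro hxν
    apply Finset.card_lt_card
    rw [Finset.ssubset_iff_of_subset]
    · exact ⟨x, Finset.mem_filter.2 ⟨mem_boxesOn.2 ⟨hxν, rfl⟩, hx⟩, by simp⟩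
    · intro u hu
      rw [Finset.mem_filter, mem_ladder hℓ] at hu
      obtain ⟨huk, hlt, hul⟩ := hu
      refine Finset.mem_filter.2 ⟨mem_boxesOn.2 ⟨?_, huk⟩, hul⟩
      by_contra huν
      exact hx (hν.isLocked_of_above hℓ hs hxν huν huk.symm hlt)

end Deregularization

/-! ### The isomorphism -/

section Isomorphism

variable {ℓ : ℕ} {μ ν : YoungDiagram}

theorem SameLadders.weight_eq (hℓ : 2 < ℓ) (h : SameLadders ℓ μ ν) :
    weight ℓ μ = weight ℓ ν := by
  classical
  have key : ∀ ξ : YoungDiagram, ∀ t : Finset ℕ, (∀ x ∈ ξ.cells, ladderIndex ℓ x ∈ t) →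
      ∑ x ∈ ξ.cells, simpleRoot ℓ (residue ℓ x) =
        ∑ k ∈ t, (boxesOn ℓ ξ k).card • simpleRoot ℓ (-(k : ZMod ℓ)) := by
    intro ξ t ht
    rw [← Finset.sum_fiberwise_of_maps_to ht]
    refine Finset.sum_congr rfl fun k _ => ?_
    rw [← Finset.sum_const]
    refine Finset.sum_congr rfl fun x hx => ?_
    rw [residue_eq_ladderIndex hℓ, (Finset.mem_filter.1 hx).2]
  rw [weight, weight,
    key μ (μ.cells.image (ladderIndex ℓ) ∪ ν.cells.image (ladderIndex ℓ)) fun x hx =>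
      Finset.mem_union_left _ (Finset.mem_image_of_mem _ hx),
    key ν (μ.cells.image (ladderIndex ℓ) ∪ ν.cells.image (ladderIndex ℓ)) fun x hx =>
      Finset.mem_union_right _ (Finset.mem_image_of_mem _ hx)]
  simp only [h _]

theorem origin_mem_of_ne_bot (h : μ ≠ ⊥) : (0, 0) ∈ μ := by
  by_contra h0
  refine h (YoungDiagram.ext (Finset.eq_empty_of_forall_notMem fun x hx => h0 ?_))
  exact μ.up_left_mem (Nat.zero_le _) (Nat.zero_le _) ((YoungDiagram.mem_cells _).1 hx)

/-- The highest removable box is normal. -/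
theorem IsTopJustified.exists_eOfWord (hℓ : 2 < ℓ) (hμ : IsTopJustified ℓ μ) (h : μ ≠ ⊥) :
    ∃ i ν, eOfWord μ (signature ℓ i μ) = some ν := by
  have h0 := origin_mem_of_ne_bot h
  rw [YoungDiagram.mem_iff_lt_rowLen] at h0
  obtain ⟨r, hr⟩ : ∃ r, μ.rowLen 0 = r + 1 := ⟨μ.rowLen 0 - 1, by omega⟩
  have h1 := (lt_rowLen_iff (μ := μ) (a := 0) (b := r)).1 (by omega)
  obtain ⟨p, hp⟩ : ∃ p, μ.colLen r = p + 1 := ⟨μ.colLen r - 1, by omega⟩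
  have hrow : ∀ a, a ≤ p → μ.rowLen a = r + 1 := by
    intro a ha
    have h2 := (lt_rowLen_iff (μ := μ) (a := a) (b := r)).2 (by omega)
    have h3 := μ.rowLen_anti 0 a (by omega)
    omega
  have hcol : μ.colLen (r + 1) = 0 := by
    have := (lt_rowLen_iff (μ := μ) (a := 0) (b := r + 1)).2
    omega
  -- By regularity, fewer than `ℓ` rows are as long as the first one; these are the rows `0` to `p`.
  have hpℓ : p + 1 < ℓ := by
    by_contra hge
    have h2 := hμ (p - (ℓ - 1)) r (by
      rw [show p - (ℓ - 1) + (ℓ - 1) = p by omega, YoungDiagram.mem_iff_lt_colLen]; omega)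
    rw [YoungDiagram.mem_iff_lt_rowLen, hrow _ (by omega)] at h2
    omega
  have hx : IsRemovable μ (p, r) := isRemovable_iff.2 ⟨hrow p le_rfl, hp⟩
  refine ⟨residue ℓ (p, r), ?_⟩
  set w := signature ℓ (residue ℓ (p, r)) μ with hw
  have hxw : (p, r) ∈ w := mem_listBy.2 (mem_signedBoxes.2 ⟨Or.inr hx, rfl⟩)
  have hnorm : (p, r) ∈ normalBoxes μ w := by
    have hpw : w.Pairwise fun x y => rowKey x < rowKey y := pairwise_listBy
    have hmem : ∀ y ∈ w, y ∈ signedBoxes ℓ (residue ℓ (p, r)) μ := fun y hy => mem_listBy.1 hy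
    rw [normalBoxes_eq, List.mem_filter]
    refine ⟨?_, by simp [sgn, hx.1]⟩
    obtain ⟨u, v, huv⟩ := List.append_of_mem hxw
    rw [huv] at hpw hmem ⊢
    refine minus_mem_red (by simp [sgn, hx.1]) fun y hy => ?_
    by_contra hs
    have hs' : sgn μ y = false := by simpa using hs
    have hyw := hmem y (by simp [hy])
    have hlt := (List.pairwise_cons.1 (List.pairwise_append.1 hpw).2.1).1 y hy
    obtain ⟨a, b⟩ := y
    obtain ⟨h2, h3⟩ := isAddable_iff.1 (isAddable_of_mem_signedBoxes hyw hs')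
    rw [rowKey_lt_iff] at hlt
    simp only at hlt
    have h4 := hrow a (by omega)
    obtain rfl : b = r + 1 := by omega
    -- A `+` after `(p, r)` could only be the end of the first row, and equal residues would make `p
    -- + 1` divisible by `ℓ`.
    have h5 := eq_of_modEq (residue_eq_iff.1 (mem_signedBoxes.1 hyw).2) (by simp only; omega)
      (by simp only; omega)
    simp only at h5
    omega
  rcases hh : (normalBoxes μ w).head? with _ | y
  · rw [List.head?_eq_none_iff] at hh
    rw [hh] at hnorm
    simp at hnorm
  · obtain ⟨hy, -⟩ := mem_signedBoxes_of_mem_normal (List.mem_of_head? hh)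
    exact ⟨LadderCrystal.removeBox μ y hy, by simp [eOfWord, hh, hy]⟩

theorem regularization_ne_bot (hℓ : 2 < ℓ) (h : ν ≠ ⊥) : regularization ℓ hℓ ν ≠ ⊥ := by
  intro h1
  have h2 := sameLadders_regularization hℓ ν (ladderIndex ℓ (0, 0))
  rw [h1] at h2
  have h3 : (0, 0) ∈ boxesOn ℓ ν (ladderIndex ℓ (0, 0)) :=
    mem_boxesOn.2 ⟨origin_mem_of_ne_bot h, rfl⟩
  have h4 := Finset.card_pos.2 ⟨_, h3⟩
  rw [← h2] at h4
  simp [boxesOn] at h4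

theorem regularization_bot (hℓ : 2 < ℓ) : regularization ℓ hℓ ⊥ = ⊥ :=
  regularization_eq hℓ (fun _ _ h => absurd h (YoungDiagram.notMem_bot _)) fun _ => rfl

theorem card_lt_of_eOfWord {w : List (ℕ × ℕ)} (hw : w.Nodup) (h : eOfWord μ w = some ν) :
    ν.cells.card < μ.cells.card := by
  obtain ⟨x, hx, -, rfl⟩ := (eOfWord_eq_some_iff hw).1 h
  exact Finset.card_erase_lt_of_mem ((YoungDiagram.mem_cells _).2 hx.1)

/-- Some `e_i` acts on the regularization, hence by intertwining on `ν` itself. The smaller diagram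
is a node by induction, and `f_i` leads back to `ν`. -/
theorem isLadderNode_of_noBalancedHook (hℓ : 2 < ℓ) :
    ∀ n, ∀ ν : YoungDiagram, ν.cells.card = n → NoBalancedHook ℓ ν → IsLadderNode ℓ ν := by
  intro n
  induction n using Nat.strong_induction_on with
  | _ n ih =>
    intro ν hn hν
    by_cases h0 : ν = ⊥
    · rw [h0]; exact IsLadderNode.empty
    · obtain ⟨i, μ, hμ⟩ := (isTopJustified_regularization hℓ ν).exists_eOfWord hℓ
        (regularization_ne_bot hℓ h0)
      rw [← regularization_eOfWord hℓ hν, Option.map_eq_some_iff] at hμ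
      obtain ⟨ξ, hξ, -⟩ := hμ
      exact IsLadderNode.step i
        (ih _ (hn ▸ card_lt_of_eOfWord nodup_listBy hξ) ξ rfl (hν.of_eOfWord hℓ hξ)) (f_of_e hℓ hξ)

/-- The nodes of the ladder crystal are the partitions without a hook whose leg has length
`(ℓ - 1) * arm - 1`. -/
theorem isLadderNode_iff (hℓ : 2 < ℓ) : IsLadderNode ℓ ν ↔ NoBalancedHook ℓ ν := by
  constructor
  · intro h
    induction h with
    | empty => exact noBalancedHook_bot
    | step i _ hν ih => exact ih.of_fOfWord hℓ hν
  · exact isLadderNode_of_noBalancedHook hℓ _ ν rfl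

/-- Remove a good box, lift the smaller partition to a ladder node by induction, and add the box
back on both sides by intertwining. -/
theorem exists_regularization_eq (hℓ : 2 < ℓ) :
    ∀ n, ∀ μ : YoungDiagram, μ.cells.card = n → IsTopJustified ℓ μ →
      ∃ ν, IsLadderNode ℓ ν ∧ regularization ℓ hℓ ν = μ := by
  intro n
  induction n using Nat.strong_induction_on with
  | _ n ih =>
    intro μ hn hμ
    by_cases h0 : μ = ⊥
    · exact ⟨⊥, IsLadderNode.empty, by rw [h0, regularization_bot]⟩
    · obtain ⟨i, ξ, hξ⟩ := hμ.exists_eOfWord hℓ h0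
      obtain ⟨ν, hν, rfl⟩ := ih _ (hn ▸ card_lt_of_eOfWord nodup_listBy hξ) ξ rfl
        (hμ.of_eOfWord hℓ hξ)
      have h1 := f_of_e hℓ hξ
      have h2 := regularization_fOfWord hℓ ((isLadderNode_iff hℓ).1 hν) i
      rw [signature, h1] at h2
      obtain ⟨κ, hκ, hκμ⟩ := Option.map_eq_some_iff.1 h2
      exact ⟨κ, IsLadderNode.step i hν hκ, hκμ⟩

theorem deregularizationCells_regularization (hℓ : 2 < ℓ) (hν : IsLadderNode ℓ ν) :
    deregularizationCells ℓ (regularization ℓ hℓ ν) = ν.cells :=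
  deregularizationCells_eq hℓ ((isLadderNode_iff hℓ).1 hν) (isTopJustified_regularization hℓ ν)
    fun k => (sameLadders_regularization hℓ ν k).symm

theorem isCrystalIso_regularization (hℓ : 2 < ℓ) :
    IsCrystalIso (ladderCrystal ℓ) (basicCrystal ℓ) (regularization ℓ hℓ) where
  source_stable :=
    ⟨fun _ _ hμ _ h => (isLadderNode_iff hℓ).2 (((isLadderNode_iff hℓ).1 hμ).of_eOfWord hℓ h),
      fun i _ hμ _ h => IsLadderNode.step i hμ h⟩
  target_stable :=
    ⟨fun _ _ hμ _ h => (isRegular_iff hℓ).2 (((isRegular_iff hℓ).1 hμ).of_eOfWord hℓ h),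
      fun _ _ hμ _ h => (isRegular_iff hℓ).2 (((isRegular_iff hℓ).1 hμ).of_fOfWord hℓ h)⟩
  bijOn := by
    refine ⟨fun ν _ => (isRegular_iff hℓ).2 (isTopJustified_regularization hℓ ν), ?_, ?_⟩
    · intro ν hν ξ hξ h
      apply YoungDiagram.ext
      rw [← deregularizationCells_regularization hℓ hν, h,
        deregularizationCells_regularization hℓ hξ]
    · intro μ hμ
      exact exists_regularization_eq hℓ _ μ rfl ((isRegular_iff hℓ).1 hμ)
  map_f i _ hν := regularization_fOfWord hℓ ((isLadderNode_iff hℓ).1 hν) i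
  map_e i _ hν := regularization_eOfWord hℓ ((isLadderNode_iff hℓ).1 hν) i
  map_ε i ν hν := by
    have h := congrArg List.length (map_label_normal hℓ ((isLadderNode_iff hℓ).1 hν)
      (isTopJustified_regularization hℓ ν) (fun k => (sameLadders_regularization hℓ ν k).symm) i)
    rw [List.length_map, List.length_map] at h
    exact h.symm
  map_φ i ν hν := by
    have h := congrArg List.length (map_label_conormal hℓ ((isLadderNode_iff hℓ).1 hν)
      (isTopJustified_regularization hℓ ν) (fun k => (sameLadders_regularization hℓ ν k).symm) i)
    rw [List.length_map, List.length_map] at h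
    exact h.symm
  map_wt ν _ := (sameLadders_regularization hℓ ν).weight_eq hℓ

end Isomorphism

end LadderCrystal

open LadderCrystal in
theorem mainTheorem3 (ℓ : ℕ) (hℓ : 2 < ℓ) :
    IsCrystalIso (ladderCrystal ℓ) (basicCrystal ℓ) (regularization ℓ hℓ) ∧
    (∀ ν ∈ (ladderCrystal ℓ).nodes,
      deregularizationCells ℓ (regularization ℓ hℓ ν) = ν.cells) ∧
    (∀ μ ∈ (basicCrystal ℓ).nodes, ∃ ν ∈ (ladderCrystal ℓ).nodes,
      ν.cells = deregularizationCells ℓ μ ∧ regularization ℓ hℓ ν = μ) := by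
  refine ⟨isCrystalIso_regularization hℓ, fun ν hν => deregularizationCells_regularization hℓ hν,
    fun μ hμ => ?_⟩
  obtain ⟨ν, hν, rfl⟩ := exists_regularization_eq hℓ _ μ rfl ((isRegular_iff hℓ).1 hμ)
  exact ⟨ν, hν, (deregularizationCells_regularization hℓ hν).symm, rfl⟩
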